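/- Let $\mathcal Y$ be the tricrystal junction with three edges $E_j=(0,\infty)$, $j=1,2,3$, let $L^2(\mathcal Y)=\bigoplus_{j=1}^3L^2(0,\infty)$ and $H^m(\mathcal Y)=\bigoplus_{j=1}^3H^m(0,\infty)$ (all functions real-valued, or all complex-valued). Let $c_1,c_2,c_3>0$, let $b_1,b_2,b_3\in\mathbb R$, let $\lambda\in\mathbb R\setminus\{0\}$, and put $$\varphi_j(x)=4\arctan\big(e^{-(x-b_j)/c_j}\big),\qquad x>0,\ j=1,2,3.$$ Let $\mathcal W_\lambda$ be the operator in $L^2(\mathcal Y)$ given by $$\mathcal W_\lambda (v_j)_{j=1}^3=\big(-c_j^2v_j''+\cos(\varphi_j)\,v_j\big)_{j=1}^3,$$ $$D(\mathcal W_\lambda)=\Big\{(v_j)_{j=1}^3\in H^2(\mathcal Y):\ c_1v_1'(0+)=c_2v_2'(0+)=c_3v_3'(0+),\ \sum_{j=1}^3c_jv_j(0+)=\lambda c_1v_1'(0+)\Big\},$$ and let $$J=\begin{pmatrix}0&I_3\\-I_3&0\end{pmatrix},\qquad \mathcal E=\begin{pmatrix}\mathcal W_\lambda&0\\0&I_3\end{pmatrix}.$$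 Then the operator $J\mathcal E$, $J\mathcal E(u,v)=(v,-\mathcal W_\lambda u)$, considered in $H^1(\mathcal Y)\times L^2(\mathcal Y)$ on its natural domain (all $(u,v)\in H^1(\mathcal Y)\times L^2(\mathcal Y)$ with $u\in D(\mathcal W_\lambda)$ and $J\mathcal E(u,v)\in H^1(\mathcal Y)\times L^2(\mathcal Y)$), has domain $D(J\mathcal E)=D(\mathcal W_\lambda)\times H^1(\mathcal Y)$ and is the infinitesimal generator of a $C_0$-semigroup on $H^1(\mathcal Y)\times L^2(\mathcal Y)$. (This is assumption $(S_1)$ of the linear instability criterion: "$J\mathcal E$ is the generator of a $C_0$-semigroup".) In particular this applies whenever the kink profile $(\varphi_j)_{j=1}^3$ itself satisfies the vertex conditions in $D(\mathcal W_\lambda)$, since these force $\lambda<0$. -/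

import Mathlib

open MeasureTheory Set Filter Topology
open scoped ContDiff NNReal

noncomputable section

namespace Tricrystal

/-! ### Function spaces on the half-line and on the tricrystal junction

`𝕜` is `ℝ` or `ℂ`; each of the three edges is the half-line `(0, ∞)`. -/

/-- `L²(0, ∞)` with values in `𝕜`. -/
abbrev L2 (𝕜 : Type*) [RCLike 𝕜] : Type _ := Lp 𝕜 2 (volume.restrict (Ioi (0 : ℝ)))

/-- `w` is the weak derivative of `u` on `(0, ∞)`: `∫ η' u = - ∫ η w` for every
test function `η ∈ C_c^∞(0, ∞)`. -/
def HasWeakDeriv {𝕜 : Type*} [RCLike 𝕜] (u w : L2 𝕜) : Prop :=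
  ∀ η : ℝ → ℝ, ContDiff ℝ ∞ η → HasCompactSupport η → tsupport η ⊆ Ioi 0 →
    ∫ x in Ioi (0 : ℝ), deriv η x • u x = - ∫ x in Ioi (0 : ℝ), η x • w x

/-- The one-sided value `u(0+) = a`: the class `u` has a representative that is continuous on
`(0, ∞)` and tends to `a` at `0` from the right. -/
def HasRightValue {𝕜 : Type*} [RCLike 𝕜] (u : L2 𝕜) (a : 𝕜) : Prop :=
  ∃ g : ℝ → 𝕜, ContinuousOn g (Ioi 0) ∧ (u =ᵐ[volume.restrict (Ioi (0 : ℝ))] g) ∧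
    Tendsto g (𝓝[>] 0) (𝓝 a)

section weak

variable {𝕜 : Type*} [RCLike 𝕜]

theorem integrable_smul_L2 (u : L2 𝕜) {η : ℝ → ℝ} (hη : Continuous η)
    (hs : HasCompactSupport η) :
    Integrable (fun x => η x • u x) (volume.restrict (Ioi (0 : ℝ))) := by
  have h1 : MemLp η 2 (volume.restrict (Ioi (0 : ℝ))) :=
    (hη.memLp_of_hasCompactSupport hs).restrict _
  exact memLp_one_iff_integrable.mp (MemLp.smul (r := 1) (Lp.memLp u) h1)

theorem HasWeakDeriv.zero : HasWeakDeriv (0 : L2 𝕜) 0 := by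
  intro η _ _ _
  have h0 : ∀ᵐ x ∂(volume.restrict (Ioi (0 : ℝ))), (0 : L2 𝕜) x = 0 :=
    Lp.coeFn_zero 𝕜 2 (volume.restrict (Ioi (0 : ℝ)))
  rw [integral_eq_zero_of_ae, integral_eq_zero_of_ae, neg_zero]
  · filter_upwards [h0] with x hx
    rw [hx, smul_zero, Pi.zero_apply]
  · filter_upwards [h0] with x hx
    rw [hx, smul_zero, Pi.zero_apply]

theorem HasWeakDeriv.add {u₁ w₁ u₂ w₂ : L2 𝕜} (h₁ : HasWeakDeriv u₁ w₁)
    (h₂ : HasWeakDeriv u₂ w₂) : HasWeakDeriv (u₁ + u₂) (w₁ + w₂) := by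
  intro η hη hs ht
  have hd : Continuous (deriv η) := hη.continuous_deriv (by simp)
  have e1 : ∫ x in Ioi (0 : ℝ), deriv η x • (u₁ + u₂) x =
      ∫ x in Ioi (0 : ℝ), (deriv η x • u₁ x + deriv η x • u₂ x) := by
    apply integral_congr_ae
    filter_upwards [Lp.coeFn_add u₁ u₂] with x hx
    rw [hx, Pi.add_apply, smul_add]
  have e2 : ∫ x in Ioi (0 : ℝ), η x • (w₁ + w₂) x =
      ∫ x in Ioi (0 : ℝ), (η x • w₁ x + η x • w₂ x) := by
    apply integral_congr_ae
    filter_upwards [Lp.coeFn_add w₁ w₂] with x hx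
    rw [hx, Pi.add_apply, smul_add]
  rw [e1, e2, integral_add (integrable_smul_L2 u₁ hd hs.deriv) (integrable_smul_L2 u₂ hd hs.deriv),
    integral_add (integrable_smul_L2 w₁ hη.continuous hs)
      (integrable_smul_L2 w₂ hη.continuous hs), h₁ η hη hs ht, h₂ η hη hs ht, neg_add]

theorem HasWeakDeriv.smul {u w : L2 𝕜} (r : 𝕜) (h : HasWeakDeriv u w) :
    HasWeakDeriv (r • u) (r • w) := by
  intro η hη hs ht
  have e1 : ∫ x in Ioi (0 : ℝ), deriv η x • (r • u) x =
      ∫ x in Ioi (0 : ℝ), r • (deriv η x • u x) := by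
    apply integral_congr_ae
    filter_upwards [Lp.coeFn_smul r u] with x hx
    rw [hx, Pi.smul_apply, smul_comm]
  have e2 : ∫ x in Ioi (0 : ℝ), η x • (r • w) x =
      ∫ x in Ioi (0 : ℝ), r • (η x • w x) := by
    apply integral_congr_ae
    filter_upwards [Lp.coeFn_smul r w] with x hx
    rw [hx, Pi.smul_apply, smul_comm]
  rw [e1, e2, integral_smul, integral_smul, h η hη hs ht, smul_neg]

theorem HasWeakDeriv.eq_zero {w : L2 𝕜} (h : HasWeakDeriv 0 w) : w = 0 := by
  have h0 : ∀ᵐ x ∂(volume.restrict (Ioi (0 : ℝ))), (0 : L2 𝕜) x = 0 :=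
    Lp.coeFn_zero 𝕜 2 (volume.restrict (Ioi (0 : ℝ)))
  have hloc : LocallyIntegrableOn (w : ℝ → 𝕜) (Ioi 0) (volume.restrict (Ioi (0 : ℝ))) :=
    ((Lp.memLp w).locallyIntegrable (by norm_num)).locallyIntegrableOn _
  have key := isOpen_Ioi.ae_eq_zero_of_integral_contDiff_smul_eq_zero hloc
    (fun η hη hs ht => by
      have e := h η hη hs ht
      rw [integral_eq_zero_of_ae] at e
      · simpa using e.symm
      · filter_upwards [h0] with x hx
        rw [hx, smul_zero, Pi.zero_apply])
  apply Lp.ext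
  filter_upwards [key, h0, ae_restrict_mem measurableSet_Ioi] with x hx h0x hm
  rw [hx hm, h0x]

/-- Weak derivatives are unique. -/
theorem HasWeakDeriv.unique {u w₁ w₂ : L2 𝕜} (h₁ : HasWeakDeriv u w₁)
    (h₂ : HasWeakDeriv u w₂) : w₁ = w₂ := by
  have h := h₁.add (h₂.smul (-1))
  have e : u + (-1 : 𝕜) • u = 0 := by simp
  rw [e] at h
  have := h.eq_zero
  rw [neg_one_smul, ← sub_eq_add_neg] at this
  exact sub_eq_zero.mp this

theorem HasRightValue.zero : HasRightValue (0 : L2 𝕜) 0 :=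
  ⟨fun _ => 0, continuousOn_const, Lp.coeFn_zero 𝕜 2 _, tendsto_const_nhds⟩

theorem HasRightValue.add {u₁ u₂ : L2 𝕜} {a₁ a₂ : 𝕜} (h₁ : HasRightValue u₁ a₁)
    (h₂ : HasRightValue u₂ a₂) : HasRightValue (u₁ + u₂) (a₁ + a₂) := by
  obtain ⟨g₁, c₁, e₁, t₁⟩ := h₁
  obtain ⟨g₂, c₂, e₂, t₂⟩ := h₂
  exact ⟨g₁ + g₂, c₁.add c₂, (Lp.coeFn_add u₁ u₂).trans (e₁.add e₂), t₁.add t₂⟩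

theorem HasRightValue.smul {u : L2 𝕜} {a : 𝕜} (r : 𝕜) (h : HasRightValue u a) :
    HasRightValue (r • u) (r • a) := by
  obtain ⟨g, c, e, t⟩ := h
  exact ⟨r • g, c.const_smul r, (Lp.coeFn_smul r u).trans (e.const_smul r), t.const_smul r⟩

end weak

/-- The weak derivative `u'` of `u ∈ H¹(0, ∞)`
(only used for such `u`; the value is `0` for other `u`). -/
def weakDeriv {𝕜 : Type*} [RCLike 𝕜] (u : L2 𝕜) : L2 𝕜 :=
  open Classical in if h : ∃ w, HasWeakDeriv u w then h.choose else 0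

theorem HasWeakDeriv.weakDeriv_eq {𝕜 : Type*} [RCLike 𝕜] {u w : L2 𝕜}
    (h : HasWeakDeriv u w) : weakDeriv u = w := by
  have hex : ∃ w, HasWeakDeriv u w := ⟨w, h⟩
  rw [weakDeriv, dif_pos hex]
  exact hex.choose_spec.unique h

/-- The Sobolev space `H¹(0, ∞)` with its usual Hilbert norm `(‖u‖² + ‖u'‖²)^(1/2)`, realized as
the space of all pairs `(u, u')` in `L² × L²` for which `u'` is the weak derivative of `u`. -/
def H1 (𝕜 : Type*) [RCLike 𝕜] : Submodule 𝕜 (WithLp 2 (L2 𝕜 × L2 𝕜)) where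
  carrier := {p | HasWeakDeriv p.fst p.snd}
  zero_mem' := HasWeakDeriv.zero
  add_mem' := fun h₁ h₂ => HasWeakDeriv.add h₁ h₂
  smul_mem' := fun r _ h => HasWeakDeriv.smul r h

instance (𝕜 : Type*) [RCLike 𝕜] : NormedAddCommGroup (H1 𝕜) := inferInstance

instance (𝕜 : Type*) [RCLike 𝕜] : InnerProductSpace 𝕜 (H1 𝕜) := inferInstance

instance (𝕜 : Type*) [RCLike 𝕜] : NormedSpace 𝕜 (H1 𝕜) := InnerProductSpace.toNormedSpace

instance (𝕜 : Type*) [RCLike 𝕜] : Module 𝕜 (H1 𝕜) := NormedSpace.toModule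

/-- `L²(𝒴) = L²(0, ∞) ⊕ L²(0, ∞) ⊕ L²(0, ∞)`. -/
abbrev L2Y (𝕜 : Type*) [RCLike 𝕜] : Type _ := PiLp 2 (fun _ : Fin 3 => L2 𝕜)

instance (𝕜 : Type*) [RCLike 𝕜] : NormedAddCommGroup (L2Y 𝕜) := inferInstance

instance (𝕜 : Type*) [RCLike 𝕜] : InnerProductSpace 𝕜 (L2Y 𝕜) := inferInstance

instance (𝕜 : Type*) [RCLike 𝕜] : NormedSpace 𝕜 (L2Y 𝕜) := InnerProductSpace.toNormedSpace

instance (𝕜 : Type*) [RCLike 𝕜] : Module 𝕜 (L2Y 𝕜) := NormedSpace.toModule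

/-- `H¹(𝒴) = H¹(0, ∞) ⊕ H¹(0, ∞) ⊕ H¹(0, ∞)`. -/
abbrev H1Y (𝕜 : Type*) [RCLike 𝕜] : Type _ := PiLp 2 (fun _ : Fin 3 => H1 𝕜)

instance (𝕜 : Type*) [RCLike 𝕜] : NormedAddCommGroup (H1Y 𝕜) := inferInstance

instance (𝕜 : Type*) [RCLike 𝕜] : InnerProductSpace 𝕜 (H1Y 𝕜) := inferInstance

instance (𝕜 : Type*) [RCLike 𝕜] : NormedSpace 𝕜 (H1Y 𝕜) := InnerProductSpace.toNormedSpace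

instance (𝕜 : Type*) [RCLike 𝕜] : Module 𝕜 (H1Y 𝕜) := NormedSpace.toModule

/-- The energy space `H¹(𝒴) × L²(𝒴)`. -/
abbrev Energy (𝕜 : Type*) [RCLike 𝕜] : Type _ := WithLp 2 (H1Y 𝕜 × L2Y 𝕜)

instance (𝕜 : Type*) [RCLike 𝕜] : NormedAddCommGroup (Energy 𝕜) := inferInstance

instance (𝕜 : Type*) [RCLike 𝕜] : InnerProductSpace 𝕜 (Energy 𝕜) := inferInstance

instance (𝕜 : Type*) [RCLike 𝕜] : NormedSpace 𝕜 (Energy 𝕜) := InnerProductSpace.toNormedSpace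

instance (𝕜 : Type*) [RCLike 𝕜] : Module 𝕜 (Energy 𝕜) := NormedSpace.toModule

/-- The space `L²(𝒴) × L²(𝒴)`. -/
abbrev L2Y2 (𝕜 : Type*) [RCLike 𝕜] : Type _ := WithLp 2 (L2Y 𝕜 × L2Y 𝕜)

instance (𝕜 : Type*) [RCLike 𝕜] : NormedAddCommGroup (L2Y2 𝕜) := inferInstance

instance (𝕜 : Type*) [RCLike 𝕜] : InnerProductSpace 𝕜 (L2Y2 𝕜) := inferInstance

instance (𝕜 : Type*) [RCLike 𝕜] : NormedSpace 𝕜 (L2Y2 𝕜) := InnerProductSpace.toNormedSpace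

instance (𝕜 : Type*) [RCLike 𝕜] : Module 𝕜 (L2Y2 𝕜) := NormedSpace.toModule

/-- The inclusion `H¹(𝒴) ⊆ L²(𝒴)`. -/
def inclH1Y (𝕜 : Type*) [RCLike 𝕜] : H1Y 𝕜 →ₗ[𝕜] L2Y 𝕜 where
  toFun v := WithLp.toLp 2 fun j => (v j).1.fst
  map_add' _ _ := rfl
  map_smul' _ _ := rfl

/-- The inclusion `H¹(𝒴) × L²(𝒴) ⊆ L²(𝒴) × L²(𝒴)`. -/
def inclEnergy (𝕜 : Type*) [RCLike 𝕜] : Energy 𝕜 →ₗ[𝕜] L2Y2 𝕜 where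
  toFun x := WithLp.toLp 2 (inclH1Y 𝕜 x.fst, x.snd)
  map_add' x y := by
    simp only [WithLp.add_fst, WithLp.add_snd, map_add]
    rfl
  map_smul' r x := by
    simp only [WithLp.smul_fst, WithLp.smul_snd, map_smul]
    rfl

theorem inclH1Y_injective (𝕜 : Type*) [RCLike 𝕜] : Function.Injective (inclH1Y 𝕜) := by
  intro v w h
  ext1 j
  have hj : (v j).1.fst = (w j).1.fst := congrArg (fun z : L2Y 𝕜 => z j) h
  have hw : HasWeakDeriv (v j).1.fst (w j).1.snd := by
    rw [hj]
    exact (w j).2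
  have hd : (v j).1.snd = (w j).1.snd := HasWeakDeriv.unique (v j).2 hw
  apply Subtype.ext
  exact WithLp.ofLp_injective 2 (Prod.ext hj hd)

theorem inclEnergy_injective (𝕜 : Type*) [RCLike 𝕜] : Function.Injective (inclEnergy 𝕜) := by
  intro x y h
  have h1 : inclH1Y 𝕜 x.fst = inclH1Y 𝕜 y.fst := congrArg (fun z : L2Y2 𝕜 => z.fst) h
  have h2 : x.snd = y.snd := congrArg (fun z : L2Y2 𝕜 => z.snd) h
  exact WithLp.ofLp_injective 2 (Prod.ext (inclH1Y_injective 𝕜 h1) h2)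

/-! ### The linearized operators -/

/-- The `δ'`-interaction domain at the vertex: all `(u_j) ∈ H²(𝒴)` with
`c₁ u₁'(0+) = c₂ u₂'(0+) = c₃ u₃'(0+)` and `∑ c_j u_j(0+) = lam c₁ u₁'(0+)`.
Here `d j` and `e j` are the first and second weak derivatives of `u j`, and `a j`, `s j` are
the values `u_j(0+)`, `u_j'(0+)`. -/
def deltaPrimeDomain (𝕜 : Type*) [RCLike 𝕜] (c : Fin 3 → ℝ) (lam : ℝ) :
    Submodule 𝕜 (L2Y 𝕜) where
  carrier := {u | ∃ d e : Fin 3 → L2 𝕜, ∃ a s : Fin 3 → 𝕜,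
    (∀ j, HasWeakDeriv (u j) (d j)) ∧ (∀ j, HasWeakDeriv (d j) (e j)) ∧
    (∀ j, HasRightValue (u j) (a j)) ∧ (∀ j, HasRightValue (d j) (s j)) ∧
    (c 0 : 𝕜) * s 0 = (c 1 : 𝕜) * s 1 ∧ (c 1 : 𝕜) * s 1 = (c 2 : 𝕜) * s 2 ∧
    ∑ j, (c j : 𝕜) * a j = (lam : 𝕜) * ((c 0 : 𝕜) * s 0)}
  zero_mem' := ⟨0, 0, 0, 0, fun _ => HasWeakDeriv.zero, fun _ => HasWeakDeriv.zero,
    fun _ => HasRightValue.zero, fun _ => HasRightValue.zero, by simp, by simp, by simp⟩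
  add_mem' := by
    rintro u v ⟨d, e, a, s, h1, h2, h3, h4, h5, h6, h7⟩
      ⟨d', e', a', s', k1, k2, k3, k4, k5, k6, k7⟩
    refine ⟨d + d', e + e', a + a', s + s', fun j => (h1 j).add (k1 j),
      fun j => (h2 j).add (k2 j), fun j => (h3 j).add (k3 j), fun j => (h4 j).add (k4 j),
      ?_, ?_, ?_⟩
    · simp only [Pi.add_apply, mul_add, h5, k5]
    · simp only [Pi.add_apply, mul_add, h6, k6]
    · simp only [Pi.add_apply, mul_add, Finset.sum_add_distrib, h7, k7]
  smul_mem' := by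
    rintro r u ⟨d, e, a, s, h1, h2, h3, h4, h5, h6, h7⟩
    refine ⟨r • d, r • e, r • a, r • s, fun j => (h1 j).smul r,
      fun j => (h2 j).smul r, fun j => (h3 j).smul r, fun j => (h4 j).smul r, ?_, ?_, ?_⟩
    · simp only [Pi.smul_apply, smul_eq_mul, mul_left_comm _ r, h5]
    · simp only [Pi.smul_apply, smul_eq_mul, mul_left_comm _ r, h6]
    · simp only [Pi.smul_apply, smul_eq_mul, mul_left_comm _ r, ← Finset.mul_sum, h7]

theorem memLp_cos_mul {𝕜 : Type*} [RCLike 𝕜] (ζ : C(ℝ, ℝ)) (u : L2 𝕜) :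
    MemLp (fun x => (Real.cos (ζ x) : 𝕜) * u x) 2 (volume.restrict (Ioi (0 : ℝ))) := by
  refine (Lp.memLp u).of_le ?_ ?_
  · refine AEStronglyMeasurable.mul ?_ (Lp.aestronglyMeasurable u)
    exact (RCLike.continuous_ofReal.comp
      (Real.continuous_cos.comp ζ.continuous)).aestronglyMeasurable
  · refine Eventually.of_forall fun x => ?_
    rw [norm_mul, RCLike.norm_ofReal]
    exact mul_le_of_le_one_left (norm_nonneg _) (Real.abs_cos_le_one _)

/-- Multiplication by `cos ζ` on `L²(0, ∞)`. -/
def mulCos (𝕜 : Type*) [RCLike 𝕜] (ζ : C(ℝ, ℝ)) : L2 𝕜 →ₗ[𝕜] L2 𝕜 where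
  toFun u := (memLp_cos_mul ζ u).toLp _
  map_add' u v := by
    rw [← MemLp.toLp_add]
    apply MemLp.toLp_congr
    filter_upwards [Lp.coeFn_add u v] with x hx
    simp only [Pi.add_apply, hx, mul_add]
  map_smul' r u := by
    rw [RingHom.id_apply, ← MemLp.toLp_const_smul]
    apply MemLp.toLp_congr
    filter_upwards [Lp.coeFn_smul r u] with x hx
    simp only [Pi.smul_apply, hx, smul_eq_mul, mul_left_comm]

/-- The operator `diag(-c_j² d²/dx² + cos ζ_j)` in `L²(𝒴)` on the `δ'`-interaction domain. -/
def schrodinger (𝕜 : Type*) [RCLike 𝕜] (c : Fin 3 → ℝ) (ζ : Fin 3 → C(ℝ, ℝ)) (lam : ℝ) :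
    L2Y 𝕜 →ₗ.[𝕜] L2Y 𝕜 where
  domain := deltaPrimeDomain 𝕜 c lam
  toFun :=
    { toFun := fun u => WithLp.toLp 2 fun j =>
        -((c j : 𝕜) ^ 2 • weakDeriv (weakDeriv (u.1 j))) + mulCos 𝕜 (ζ j) (u.1 j)
      map_add' := by
        intro u v
        ext1 j
        obtain ⟨d, e, a, s, h1, h2, -⟩ := u.2
        obtain ⟨d', e', a', s', k1, k2, -⟩ := v.2
        have A : weakDeriv ((u + v).1 j) = d j + d' j := ((h1 j).add (k1 j)).weakDeriv_eq
        have B : (u + v).1 j = u.1 j + v.1 j := rfl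
        simp only [PiLp.add_apply]
        rw [A, B, ((h2 j).add (k2 j)).weakDeriv_eq, (h1 j).weakDeriv_eq, (h2 j).weakDeriv_eq,
          (k1 j).weakDeriv_eq, (k2 j).weakDeriv_eq, map_add, smul_add]
        abel
      map_smul' := by
        intro r u
        ext1 j
        obtain ⟨d, e, a, s, h1, h2, -⟩ := u.2
        have A : weakDeriv ((r • u).1 j) = r • d j := ((h1 j).smul r).weakDeriv_eq
        have B : (r • u).1 j = r • u.1 j := rfl
        simp only [PiLp.smul_apply, RingHom.id_apply]
        rw [A, B, ((h2 j).smul r).weakDeriv_eq, (h1 j).weakDeriv_eq, (h2 j).weakDeriv_eq,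
          map_smul, smul_add, smul_neg, smul_comm r] }

/-- The kink `x ↦ 4 arctan (exp (-(x - b) / c))` on an edge with characteristic speed `c`. -/
def kink (c b : ℝ) : C(ℝ, ℝ) where
  toFun x := 4 * Real.arctan (Real.exp (-(x - b) / c))
  continuous_toFun := by fun_prop

/-- The linearization `𝒲_lam = diag(-c_j² d²/dx² + cos φ_j)` around the kinks
`φ_j = 4 arctan (exp (-(x - b_j) / c_j))`. -/
def kinkLinearization (𝕜 : Type*) [RCLike 𝕜] (c b : Fin 3 → ℝ) (lam : ℝ) :
    L2Y 𝕜 →ₗ.[𝕜] L2Y 𝕜 :=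
  schrodinger 𝕜 c (fun j => kink (c j) (b j)) lam

/-- The block-diagonal operator `diag(W, I)` in `L²(𝒴) × L²(𝒴)`, with domain `D(W) × L²(𝒴)`. -/
def diagId {𝕜 : Type*} [RCLike 𝕜] (W : L2Y 𝕜 →ₗ.[𝕜] L2Y 𝕜) : L2Y2 𝕜 →ₗ.[𝕜] L2Y2 𝕜 where
  domain :=
    { carrier := {x | x.fst ∈ W.domain}
      zero_mem' := W.domain.zero_mem
      add_mem' := fun h k => W.domain.add_mem h k
      smul_mem' := fun r _ h => W.domain.smul_mem r h }
  toFun :=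
    { toFun := fun x => WithLp.toLp 2 (W ⟨x.1.fst, x.2⟩, x.1.snd)
      map_add' := by
        rintro ⟨x, hx⟩ ⟨y, hy⟩
        apply WithLp.ofLp_injective 2
        exact Prod.ext (W.map_add ⟨x.fst, hx⟩ ⟨y.fst, hy⟩) rfl
      map_smul' := by
        rintro r ⟨x, hx⟩
        apply WithLp.ofLp_injective 2
        exact Prod.ext (W.map_smul r ⟨x.fst, hx⟩) rfl }

/-- The matrix `J = (0, I; -I, 0)`, that is `J (u, v) = (v, -u)`. -/
def opJ (𝕜 : Type*) [RCLike 𝕜] : L2Y2 𝕜 →ₗ[𝕜] L2Y2 𝕜 where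
  toFun x := WithLp.toLp 2 (x.snd, -x.fst)
  map_add' x y := by
    simp only [WithLp.add_fst, WithLp.add_snd, neg_add]
    rfl
  map_smul' r x := by
    simp only [WithLp.smul_fst, WithLp.smul_snd, ← smul_neg]
    rfl

/-- The part in the energy space `H¹(𝒴) × L²(𝒴)` of an operator `A` in `L²(𝒴) × L²(𝒴)`:
its domain is `{x ∈ D(A) : x and A x lie in H¹(𝒴) × L²(𝒴)}`, and it acts there as `A`. -/
def partInEnergy {𝕜 : Type*} [RCLike 𝕜] (A : L2Y2 𝕜 →ₗ.[𝕜] L2Y2 𝕜) :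
    Energy 𝕜 →ₗ.[𝕜] Energy 𝕜 :=
  (A.graph.comap ((inclEnergy 𝕜).prodMap (inclEnergy 𝕜))).toLinearPMap

theorem mem_graph_partInEnergy {𝕜 : Type*} [RCLike 𝕜] (A : L2Y2 𝕜 →ₗ.[𝕜] L2Y2 𝕜)
    (x y : Energy 𝕜) :
    (x, y) ∈ (partInEnergy A).graph ↔ (inclEnergy 𝕜 x, inclEnergy 𝕜 y) ∈ A.graph := by
  rw [partInEnergy, Submodule.toLinearPMap_graph_eq]
  · rfl
  · rintro ⟨x, y⟩ h hx
    have hx' : x = 0 := hx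
    have h' : (inclEnergy 𝕜 x, inclEnergy 𝕜 y) ∈ A.graph := h
    have : inclEnergy 𝕜 y = 0 := A.graph_fst_eq_zero_snd h' (by simp [hx'])
    exact inclEnergy_injective 𝕜 (by simpa using this)

/-- The operator `J ℰ` in `H¹(𝒴) × L²(𝒴)`, where `ℰ = diag(𝒲_lam, I)`. -/
def kinkJE (𝕜 : Type*) [RCLike 𝕜] (c b : Fin 3 → ℝ) (lam : ℝ) : Energy 𝕜 →ₗ.[𝕜] Energy 𝕜 :=
  partInEnergy ((opJ 𝕜).compPMap (diagId (kinkLinearization 𝕜 c b lam)))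

/-! ### Strongly continuous semigroups -/

/-- `(S t)_{t ≥ 0}` is a `C₀`-semigroup of bounded linear operators on `X`. -/
structure IsC0Semigroup {𝕜 X : Type*} [RCLike 𝕜] [NormedAddCommGroup X] [NormedSpace 𝕜 X]
    (S : ℝ≥0 → X →L[𝕜] X) : Prop where
  zero : S 0 = ContinuousLinearMap.id 𝕜 X
  add : ∀ s t, S (s + t) = (S s).comp (S t)
  strong_continuity : ∀ x, Tendsto (fun t => S t x) (𝓝 0) (𝓝 x)

/-- `A` is the infinitesimal generator of `S`: `x ∈ D(A)` and `A x = y` if and only if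
`(S t x - x) / t → y` as `t → 0+`. -/
def IsGenerator {𝕜 X : Type*} [RCLike 𝕜] [NormedAddCommGroup X] [NormedSpace 𝕜 X]
    (A : X →ₗ.[𝕜] X) (S : ℝ≥0 → X →L[𝕜] X) : Prop :=
  ∀ x y, (x, y) ∈ A.graph ↔
    Tendsto (fun t : ℝ≥0 => (((t : ℝ) : 𝕜)⁻¹) • (S t x - x)) (𝓝[>] 0) (𝓝 y)

end Tricrystal

end

/-! The operator `𝒲_λ` is the operator of the symmetric form `∑ c_j² ⟨u_j', v_j'⟩ + λ⁻¹ ⟨∑ c_j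
u_j(0+), ∑ c_j v_j(0+)⟩ + ∑ ⟨cos φ_j u_j, v_j⟩` on all of `H¹(𝒴)`. No vertex condition is imposed on
the form domain: testing with functions of nonzero trace makes the conditions in `D(𝒲_λ)` appear as
natural boundary conditions. This is `mem_graph_schrodinger_iff`, which rests on the one-edge
statement `H1.weak_neumann_iff`.

The bound `|u(0+)|² ≤ 2 ‖u‖ ‖u'‖` lets the gradient term absorb the vertex term up to a multiple of
`‖u‖²`, whatever the sign of `λ`. Hence the form plus `K ‖u‖²` is coercive on `H¹(𝒴)`
(`exists_coercive_formOp`), and together with the `L²` norm of the second component it gives an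
equivalent inner product on the energy space. In that inner product the terms of `⟨J ℰ x, x⟩` coming
from the form cancel by symmetry. Only a bounded term with factor `K` remains, so `J ℰ` is
dissipative up to a shift. The range condition reduces to solving `(𝒲_λ + l²) u = f` weakly, which
coercivity allows for large `l` (`exists_isGenerator_wave`).

Generation then follows from the Lumer-Phillips theorem, deduced from the Hille-Yosida theorem,
which is proved here by Yosida approximation. The description of the domain is read off from the
graph of `J ℰ`. -/

namespace Tricrystal

/-! ### Estimates for exponentials of bounded operators -/

section semigroup

variable {𝕜 X : Type*} [RCLike 𝕜] [NormedAddCommGroup X] [NormedSpace 𝕜 X] [CompleteSpace X]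

/-- Addition formula for the exponentials of commuting bounded operators. -/
theorem exp_add_of_commute_clm {B B' : X →L[𝕜] X} (h : Commute B B') :
    NormedSpace.exp (B + B') = NormedSpace.exp B * NormedSpace.exp B' := by
  let _ : NormedAlgebra ℚ (X →L[𝕜] X) := NormedAlgebra.restrictScalars ℚ 𝕜 _
  exact NormedSpace.exp_add_of_commute h

theorem hasDerivAt_exp_smul_apply [NormedSpace ℝ X] [IsScalarTower ℝ 𝕜 X]
    (B : X →L[𝕜] X) (x : X) (t : ℝ) :
    HasDerivAt (fun s : ℝ => NormedSpace.exp ((s : 𝕜) • B) x)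
      (NormedSpace.exp ((t : 𝕜) • B) (B x)) t := by
  have h1 : HasDerivAt (fun s : 𝕜 => NormedSpace.exp (s • B) x)
      (NormedSpace.exp ((t : 𝕜) • B) (B x)) (t : 𝕜) :=
    ((ContinuousLinearMap.apply 𝕜 X x).hasFDerivAt.comp_hasDerivAt (t : 𝕜)
      (hasDerivAt_exp_smul_const (𝕂 := 𝕜) B (t : 𝕜)))
  have h2 : HasDerivAt (fun s : ℝ => (s : 𝕜)) 1 t := by
    simpa using (RCLike.ofRealCLM (K := 𝕜)).hasDerivAt (x := t)
  have h3 := h1.scomp t h2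
  rw [one_smul] at h3
  exact h3

/-- The exponential orbits of two commuting bounded operators differ by at most
`t` times the difference of the operators. -/
theorem norm_exp_smul_sub_exp_smul_le {B B' : X →L[𝕜] X} (h : Commute B B') {C C' t : ℝ}
    (ht : 0 ≤ t) (hC0 : 0 ≤ C)
    (hC : ∀ s ∈ Icc 0 t, ‖NormedSpace.exp ((s : 𝕜) • B)‖ ≤ C)
    (hC' : ∀ s ∈ Icc 0 t, ‖NormedSpace.exp ((s : 𝕜) • B')‖ ≤ C') (x : X) :
    ‖NormedSpace.exp ((t : 𝕜) • B) x - NormedSpace.exp ((t : 𝕜) • B') x‖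
      ≤ C * (C' * ‖B x - B' x‖) * t := by
  let _ : NormedSpace ℝ X := NormedSpace.restrictScalars ℝ 𝕜 X
  have : IsScalarTower ℝ 𝕜 X := RestrictScalars.isScalarTower ℝ 𝕜 X
  have hc1 (a b : 𝕜) : Commute (a • B) (b • B') := (h.smul_left a).smul_right b
  -- The curve `s ↦ exp (s (B - B')) exp (t B') x` joins `exp (t B') x` to `exp (t B) x`. In the
  -- factored form both exponents have times in `[0, t]`, the only times at which bounds are
  -- assumed.
  have key (s : ℝ) : NormedSpace.exp ((s : 𝕜) • (B - B')) * NormedSpace.exp ((t : 𝕜) • B')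
      = NormedSpace.exp ((s : 𝕜) • B) * NormedSpace.exp (((t - s : ℝ) : 𝕜) • B') := by
    rw [← exp_add_of_commute_clm (hc1 _ _), ← exp_add_of_commute_clm]
    · congr 1
      push_cast
      module
    · exact (((h.sub_left (Commute.refl B')).smul_left _).smul_right _)
  have hcomm : Commute (B - B') (NormedSpace.exp ((t : 𝕜) • B')) :=
    (((h.sub_left (Commute.refl B'))).smul_right _).exp_right
  have hd (s : ℝ) := hasDerivAt_exp_smul_apply (B - B') (NormedSpace.exp ((t : 𝕜) • B') x) s
  have hb : ∀ s ∈ Ico 0 t, ‖NormedSpace.exp ((s : 𝕜) • (B - B'))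
      ((B - B') (NormedSpace.exp ((t : 𝕜) • B') x))‖ ≤ C * (C' * ‖B x - B' x‖) := by
    intro s hs
    have e : NormedSpace.exp ((s : 𝕜) • (B - B')) ((B - B') (NormedSpace.exp ((t : 𝕜) • B') x))
        = NormedSpace.exp ((s : 𝕜) • B)
          (NormedSpace.exp (((t - s : ℝ) : 𝕜) • B') (B x - B' x)) := by
      have e1 := congrArg (fun Z : X →L[𝕜] X => Z x) hcomm.eq
      have e2 := congrArg (fun Z : X →L[𝕜] X => Z (B x - B' x)) (key s)
      simp only [mul_apply_eq_comp, sub_apply] at e1 e2 ⊢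
      rw [e1, e2]
    rw [e]
    refine (ContinuousLinearMap.le_opNorm _ _).trans ?_
    have hm := hC' (t - s) ⟨by linarith [hs.2], by linarith [hs.1]⟩
    exact mul_le_mul (hC s ⟨hs.1, hs.2.le⟩)
      (((ContinuousLinearMap.le_opNorm _ _)).trans
        (mul_le_mul_of_nonneg_right hm (norm_nonneg _))) (norm_nonneg _) hC0
  have := norm_image_sub_le_of_norm_deriv_le_segment'
    (fun s _ => (hd s).hasDerivWithinAt) hb t (right_mem_Icc.2 ht)
  have e3 := congrArg (fun Z : X →L[𝕜] X => Z x) (key t)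
  simp only [mul_apply_eq_comp, sub_self, RCLike.ofReal_zero, zero_smul,
    NormedSpace.exp_zero, one_apply_eq_self] at e3 this
  rwa [e3, sub_zero] at this

theorem norm_exp_smul_apply_sub_le {B : X →L[𝕜] X} {C t : ℝ} (ht : 0 ≤ t) (hC0 : 0 ≤ C)
    (hC : ∀ s ∈ Icc 0 t, ‖NormedSpace.exp ((s : 𝕜) • B)‖ ≤ C) (x : X) :
    ‖NormedSpace.exp ((t : 𝕜) • B) x - x‖ ≤ C * ‖B x‖ * t := by
  have h := norm_exp_smul_sub_exp_smul_le (𝕜 := 𝕜) (B' := (0 : X →L[𝕜] X)) (C' := 1)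
    (Commute.zero_right B) ht hC0 hC (fun s _ => by
      rw [smul_zero, NormedSpace.exp_zero]; exact ContinuousLinearMap.norm_id_le) x
  simpa using h

/-- First order Taylor estimate for an exponential orbit. -/
theorem norm_exp_smul_apply_sub_sub_le {B : X →L[𝕜] X} {C t : ℝ} (ht : 0 ≤ t) (hC0 : 0 ≤ C)
    (hC : ∀ s ∈ Icc 0 t, ‖NormedSpace.exp ((s : 𝕜) • B)‖ ≤ C) (x z : X) :
    ‖NormedSpace.exp ((t : 𝕜) • B) x - x - (t : 𝕜) • B x‖
      ≤ ((C + 1) * ‖B x - z‖ + C * ‖B z‖ * t) * t := by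
  let _ : NormedSpace ℝ X := NormedSpace.restrictScalars ℝ 𝕜 X
  have : IsScalarTower ℝ 𝕜 X := RestrictScalars.isScalarTower ℝ 𝕜 X
  have hd (s : ℝ) : HasDerivAt (fun s : ℝ => NormedSpace.exp ((s : 𝕜) • B) x - s • B x)
      (NormedSpace.exp ((s : 𝕜) • B) (B x) - B x) s := by
    have h3 := (hasDerivAt_exp_smul_apply B x s).sub ((hasDerivAt_id s).smul_const (B x))
    rw [one_smul] at h3
    exact h3
  have hb : ∀ s ∈ Ico 0 t, ‖NormedSpace.exp ((s : 𝕜) • B) (B x) - B x‖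
      ≤ (C + 1) * ‖B x - z‖ + C * ‖B z‖ * t := by
    intro s hs
    -- Along Yosida approximations `‖B (B x)‖` need not stay bounded. So `B x` is replaced by a
    -- nearby `z` for which `‖B z‖` does.
    have e : NormedSpace.exp ((s : 𝕜) • B) (B x) - B x
        = NormedSpace.exp ((s : 𝕜) • B) (B x - z) - (B x - z)
          + (NormedSpace.exp ((s : 𝕜) • B) z - z) := by
      rw [map_sub]; abel
    have h1 : ‖NormedSpace.exp ((s : 𝕜) • B) (B x - z)‖ ≤ C * ‖B x - z‖ :=
      (ContinuousLinearMap.le_opNorm _ _).trans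
        (mul_le_mul_of_nonneg_right (hC s ⟨hs.1, hs.2.le⟩) (norm_nonneg _))
    have h2 := norm_exp_smul_apply_sub_le (𝕜 := 𝕜) (B := B) hs.1 hC0
      (fun r hr => hC r ⟨hr.1, hr.2.trans hs.2.le⟩) z
    have h3 : C * ‖B z‖ * s ≤ C * ‖B z‖ * t :=
      mul_le_mul_of_nonneg_left hs.2.le (by positivity)
    rw [e]
    refine (norm_add_le _ _).trans ?_
    have := norm_sub_le (NormedSpace.exp ((s : 𝕜) • B) (B x - z)) (B x - z)
    linarith
  have := norm_image_sub_le_of_norm_deriv_le_segment'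
    (fun s _ => (hd s).hasDerivWithinAt) hb t (right_mem_Icc.2 ht)
  have e1 : t • B x = (t : 𝕜) • B x := (RCLike.real_smul_eq_coe_smul (K := 𝕜) t (B x))
  simp only [RCLike.ofReal_zero, zero_smul, NormedSpace.exp_zero, sub_zero, e1,
    one_apply_eq_self] at this
  convert this using 2
  abel

/-- A uniformly bounded sequence of operators that is Cauchy on a dense set converges strongly. -/
theorem exists_tendsto_of_dense {T : ℕ → X →L[𝕜] X} {C : ℝ} (hC : ∀ n, ‖T n‖ ≤ C) {D : Set X}
    (hD : Dense D) (h : ∀ x ∈ D, CauchySeq fun n => T n x) :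
    ∃ S : X →L[𝕜] X, ∀ x, Tendsto (fun n => T n x) atTop (𝓝 (S x)) := by
  have hC0 : 0 ≤ C := (norm_nonneg _).trans (hC 0)
  have hcauchy (x : X) : CauchySeq fun n => T n x := by
    rw [Metric.cauchySeq_iff']
    intro ε hε
    have hδ : 0 < ε / (3 * (C + 1)) := by positivity
    obtain ⟨x', hx', hd⟩ := Metric.mem_closure_iff.1 (hD x) _ hδ
    obtain ⟨N, hN⟩ := Metric.cauchySeq_iff'.1 (h x' hx') (ε / 3) (by positivity)
    refine ⟨N, fun n hn => ?_⟩
    have hb (m : ℕ) : dist (T m x) (T m x') ≤ ε / 3 := by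
      rw [dist_eq_norm, ← map_sub]
      calc ‖T m (x - x')‖ ≤ ‖T m‖ * ‖x - x'‖ := ContinuousLinearMap.le_opNorm _ _
        _ ≤ (C + 1) * (ε / (3 * (C + 1))) := by
            rw [dist_eq_norm] at hd
            exact mul_le_mul (by linarith [hC m]) hd.le (norm_nonneg _) (by positivity)
        _ = ε / 3 := by field_simp
    have := dist_triangle4 (T n x) (T n x') (T N x') (T N x)
    have h1 := hb n
    have h2 := hb N
    rw [dist_comm] at h2
    linarith [hN n hn]
  choose f hf using fun x => cauchySeq_tendsto_of_complete (hcauchy x)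
  exact ⟨continuousLinearMapOfTendsto T (tendsto_pi_nhds.2 hf), hf⟩

end semigroup

/-! ### Yosida approximation and the Hille-Yosida theorem -/

section approximation

variable {𝕜 X : Type*} [RCLike 𝕜] [NormedAddCommGroup X] [NormedSpace 𝕜 X] [CompleteSpace X]

/-- If bounded commuting operators `B n` with uniformly exponentially bounded exponentials
converge to a densely defined operator `A` on its domain, and `A` has a resolvent commuting with
all `B n`, then `A` generates a `C₀`-semigroup. -/
theorem exists_isGenerator_of_tendsto {A : X →ₗ.[𝕜] X} (hA : Dense (A.domain : Set X))
    {B : ℕ → X →L[𝕜] X} (hB : ∀ n m, Commute (B n) (B m)) {C σ : ℝ} (hC0 : 0 ≤ C) (hσ : 0 ≤ σ)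
    (hbd : ∀ n, ∀ t : ℝ, 0 ≤ t → ‖NormedSpace.exp ((t : 𝕜) • B n)‖ ≤ C * Real.exp (σ * t))
    (hconv : ∀ x y, (x, y) ∈ A.graph → Tendsto (fun n => B n x) atTop (𝓝 y))
    {R : X →L[𝕜] X} {l : 𝕜} (hR : ∀ x, (R x, l • R x - x) ∈ A.graph)
    (hRB : ∀ n, Commute R (B n)) :
    ∃ S : ℝ≥0 → X →L[𝕜] X, IsC0Semigroup S ∧ IsGenerator A S := by
  have hgr {x : X} (hx : x ∈ A.domain) : ∃ y, (x, y) ∈ A.graph := ⟨A ⟨x, hx⟩, A.mem_graph ⟨x, hx⟩⟩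
  set K : ℝ → ℝ := fun t => C * Real.exp (σ * t)
  have hK0 (t : ℝ) : 0 ≤ K t := by positivity
  have hKmono {s t : ℝ} (h : s ≤ t) : K s ≤ K t :=
    mul_le_mul_of_nonneg_left (Real.exp_le_exp.2 (mul_le_mul_of_nonneg_left h hσ)) hC0
  have hbd' (n : ℕ) (t : ℝ) : ∀ s ∈ Icc 0 t, ‖NormedSpace.exp ((s : 𝕜) • B n)‖ ≤ K t :=
    fun s hs => (hbd n s hs.1).trans (hKmono hs.2)
  have hex (t : ℝ≥0) : ∃ S : X →L[𝕜] X, ∀ x,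
      Tendsto (fun n => NormedSpace.exp (((t : ℝ) : 𝕜) • B n) x) atTop (𝓝 (S x)) := by
    -- On the domain, `exp (t B n) x` is Cauchy because `B n x` is, by the comparison estimate for
    -- commuting exponentials.
    refine exists_tendsto_of_dense (fun n => hbd n t t.2) hA fun x hx => ?_
    obtain ⟨y, hy⟩ := hgr hx
    have h1 := cauchySeq_iff_tendsto_dist_atTop_0.1 (hconv x y hy).cauchySeq
    have h2 := (h1.const_mul (K t)).const_mul (K t) |>.mul_const (t : ℝ)
    simp only [mul_zero, zero_mul] at h2
    refine cauchySeq_iff_tendsto_dist_atTop_0.2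
      (squeeze_zero (fun _ => dist_nonneg) (fun p => ?_) h2)
    rw [dist_eq_norm, dist_eq_norm]
    exact norm_exp_smul_sub_exp_smul_le (hB _ _) t.2 (hK0 _) (hbd' _ _) (hbd' _ _) x
  choose S hS using hex
  have hSn (t : ℝ≥0) (x : X) : ‖S t x‖ ≤ K t * ‖x‖ := by
    refine le_of_tendsto (hS t x).norm (Eventually.of_forall fun n => ?_)
    exact (ContinuousLinearMap.le_opNorm _ _).trans
      (mul_le_mul_of_nonneg_right (hbd n t t.2) (norm_nonneg _))
  have hfirst {x y : X} (h : (x, y) ∈ A.graph) (t : ℝ≥0) : ‖S t x - x‖ ≤ K t * ‖y‖ * t := by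
    refine le_of_tendsto_of_tendsto ((hS t x).sub_const x).norm
      (((hconv x y h).norm.const_mul (K t)).mul_const (t : ℝ)) (Eventually.of_forall fun n => ?_)
    exact norm_exp_smul_apply_sub_le t.2 (hK0 _) (hbd' _ _) x
  have hsecond {x y z w : X} (h : (x, y) ∈ A.graph) (h' : (z, w) ∈ A.graph) (t : ℝ≥0) :
      ‖S t x - x - ((t : ℝ) : 𝕜) • y‖ ≤ ((K t + 1) * ‖y - z‖ + K t * ‖w‖ * t) * t := by
    refine le_of_tendsto_of_tendsto
      (((hS t x).sub_const x).sub ((hconv x y h).const_smul _)).norm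
      (((((hconv x y h).sub_const z).norm.const_mul (K t + 1)).add
        (((hconv z w h').norm.const_mul (K t)).mul_const (t : ℝ))).mul_const (t : ℝ))
      (Eventually.of_forall fun n => ?_)
    exact norm_exp_smul_apply_sub_sub_le t.2 (hK0 _) (hbd' _ _) x z
  have hsmall : ∀ᶠ t : ℝ≥0 in 𝓝 0, t ≤ 1 := Iic_mem_nhds zero_lt_one
  have hlin (a ε : ℝ) (hε : 0 < ε) : ∀ᶠ t : ℝ≥0 in 𝓝 0, a * t < ε := by
    have : Tendsto (fun t : ℝ≥0 => a * (t : ℝ)) (𝓝 0) (𝓝 (a * ((0 : ℝ≥0) : ℝ))) :=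
      (NNReal.continuous_coe.tendsto 0).const_mul a
    rw [NNReal.coe_zero, mul_zero] at this
    exact this.eventually_lt_const hε
  have hstrong (x : X) : Tendsto (fun t => S t x) (𝓝 0) (𝓝 x) := by
    rw [Metric.tendsto_nhds]
    intro ε hε
    have hK1 := hK0 1
    obtain ⟨x', hx', hd⟩ := Metric.mem_closure_iff.1 (hA x) (ε / (2 * (K 1 + 1))) (by positivity)
    obtain ⟨y', hy'⟩ := hgr hx'
    filter_upwards [hsmall, hlin (K 1 * ‖y'‖) (ε / 2) (by positivity)] with t ht1 ht2
    have hKt : K t ≤ K 1 := hKmono (by exact_mod_cast ht1)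
    rw [dist_eq_norm] at hd ⊢
    have e : S t x - x = S t (x - x') - (x - x') + (S t x' - x') := by rw [map_sub]; abel
    have h1 : ‖S t (x - x')‖ ≤ K 1 * ‖x - x'‖ :=
      (hSn t _).trans (mul_le_mul_of_nonneg_right hKt (norm_nonneg _))
    have h2 : ‖S t x' - x'‖ ≤ K 1 * ‖y'‖ * t := (hfirst hy' t).trans
      (mul_le_mul_of_nonneg_right (mul_le_mul_of_nonneg_right hKt (norm_nonneg _)) t.2)
    have h3 : (K 1 + 1) * ‖x - x'‖ ≤ ε / 2 := by
      rw [lt_div_iff₀ (by positivity)] at hd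
      linarith
    rw [e]
    refine (norm_add_le _ _).trans_lt ?_
    have := norm_sub_le (S t (x - x')) (x - x')
    linarith
  have hgen {x y : X} (h : (x, y) ∈ A.graph) :
      Tendsto (fun t : ℝ≥0 => (((t : ℝ) : 𝕜)⁻¹) • (S t x - x)) (𝓝[>] 0) (𝓝 y) := by
    rw [Metric.tendsto_nhds]
    intro ε hε
    have hK1 := hK0 1
    obtain ⟨z, hz, hd⟩ := Metric.mem_closure_iff.1 (hA y) (ε / (2 * (K 1 + 1))) (by positivity)
    obtain ⟨w, hw⟩ := hgr hz
    filter_upwards [nhdsWithin_le_nhds hsmall,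
      nhdsWithin_le_nhds (hlin (K 1 * ‖w‖) (ε / 2) (by positivity)), self_mem_nhdsWithin]
      with t ht1 ht2 ht0
    have ht0' : 0 < (t : ℝ) := ht0
    have hKt : K t ≤ K 1 := hKmono (by exact_mod_cast ht1)
    have hne : ((t : ℝ) : 𝕜) ≠ 0 := by exact_mod_cast ht0'.ne'
    rw [dist_eq_norm] at hd ⊢
    have e : (((t : ℝ) : 𝕜)⁻¹) • (S t x - x) - y
        = (((t : ℝ) : 𝕜)⁻¹) • (S t x - x - ((t : ℝ) : 𝕜) • y) := by
      rw [smul_sub _ (S t x - x), inv_smul_smul₀ hne]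
    have h1 := hsecond h hw t
    rw [e, norm_smul, norm_inv, RCLike.norm_ofReal, abs_of_pos ht0', inv_mul_lt_iff₀ ht0']
    have h3 : (K 1 + 1) * ‖y - z‖ < ε / 2 := by
      rw [lt_div_iff₀ (by positivity)] at hd
      linarith
    have h4 : (K t + 1) * ‖y - z‖ ≤ (K 1 + 1) * ‖y - z‖ :=
      mul_le_mul_of_nonneg_right (by linarith) (norm_nonneg _)
    have h5 : K t * ‖w‖ * t ≤ K 1 * ‖w‖ * t :=
      mul_le_mul_of_nonneg_right (mul_le_mul_of_nonneg_right hKt (norm_nonneg _)) t.2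
    refine h1.trans_lt ?_
    rw [mul_comm]
    exact mul_lt_mul_of_pos_left (by linarith) ht0'
  -- Needed to show that the generator of `S` does not properly extend `A`.
  have hRS (t : ℝ≥0) (x : X) : R (S t x) = S t (R x) := by
    refine tendsto_nhds_unique ((R.continuous.tendsto _).comp (hS t x)) ?_
    refine (hS t (R x)).congr fun n => ?_
    exact (congrArg (fun Z : X →L[𝕜] X => Z x) (((hRB n).smul_right _).exp_right).eq).symm
  refine ⟨S, ⟨?_, fun s t => ?_, hstrong⟩, fun x y => ⟨hgen, fun h => ?_⟩⟩
  · ext x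
    refine tendsto_nhds_unique (hS 0 x) ?_
    simp
  · ext x
    refine tendsto_nhds_unique (hS (s + t) x) ?_
    -- Both the operator and the vector vary with `n`; the uniform bound on the exponentials removes
    -- the error in the vector.
    have e (n : ℕ) : NormedSpace.exp ((((s + t : ℝ≥0) : ℝ) : 𝕜) • B n) x
        = NormedSpace.exp (((s : ℝ) : 𝕜) • B n)
            (NormedSpace.exp (((t : ℝ) : 𝕜) • B n) x - S t x)
          + NormedSpace.exp (((s : ℝ) : 𝕜) • B n) (S t x) := by
      rw [map_sub, sub_add_cancel, NNReal.coe_add, RCLike.ofReal_add, add_smul,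
        exp_add_of_commute_clm (((Commute.refl (B n)).smul_left _).smul_right _)]
      rfl
    simp_rw [e]
    have h0 : Tendsto (fun n => NormedSpace.exp (((s : ℝ) : 𝕜) • B n)
        (NormedSpace.exp (((t : ℝ) : 𝕜) • B n) x - S t x)) atTop (𝓝 0) := by
      have h1 := (((hS t x).sub_const (S t x)).norm.const_mul (K s))
      rw [sub_self, norm_zero, mul_zero] at h1
      refine squeeze_zero_norm (fun n => ?_) h1
      exact (ContinuousLinearMap.le_opNorm _ _).trans
        (mul_le_mul_of_nonneg_right (hbd n s s.2) (norm_nonneg _))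
    simpa using h0.add (hS s (S t x))
  -- If the difference quotients at `x` tend to `y`, applying `R` gives those at `R x ∈ D(A)`, so `R
  -- y = l R x - x`. Thus `x = R (l x - y)` lies in `D(A)`, and `A x = y`.
  · have h1 := (R.continuous.tendsto _).comp h
    have h2 := hgen (hR x)
    have h3 : R y = l • R x - x := by
      refine tendsto_nhds_unique h1 (h2.congr fun t => ?_)
      simp [hRS]
    have h4 := hR (l • x - y)
    have h5 : R (l • x - y) = x := by rw [map_sub, map_smul, h3]; abel
    rw [h5] at h4
    simpa using h4

/-- Power bounds for `P` give exponential bounds for `exp (s P)`. -/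
theorem norm_exp_smul_le_of_norm_pow_le {P : X →L[𝕜] X} {M r : ℝ}
    (h : ∀ k, ‖P ^ k‖ ≤ M * r ^ k) {s : ℝ} (hs : 0 ≤ s) :
    ‖NormedSpace.exp ((s : 𝕜) • P)‖ ≤ M * Real.exp (s * r) := by
  -- Bounding the series termwise by the powers keeps `M` outside the exponential; the bound on
  -- `‖P‖` alone would give `exp (s M r)`.
  have h1 := (NormedSpace.exp_series_hasSum_exp' (𝕂 := 𝕜) ((s : 𝕜) • P))
  have h2 : HasSum (fun k : ℕ => M * ((k.factorial⁻¹ : ℝ) • (s * r) ^ k))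
      (M * NormedSpace.exp (s * r)) :=
    (NormedSpace.exp_series_hasSum_exp' (𝕂 := ℝ) (s * r)).mul_left M
  rw [← Real.exp_eq_exp_ℝ] at h2
  rw [← h1.tsum_eq]
  refine tsum_of_norm_bounded h2 fun k => ?_
  rw [norm_smul, smul_pow, norm_smul, norm_inv, norm_pow, RCLike.norm_natCast,
    RCLike.norm_ofReal, abs_of_nonneg hs]
  calc (k.factorial : ℝ)⁻¹ * (s ^ k * ‖P ^ k‖)
      ≤ (k.factorial : ℝ)⁻¹ * (s ^ k * (M * r ^ k)) := by gcongr; exact h k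
    _ = M * ((k.factorial⁻¹ : ℝ) • (s * r) ^ k) := by rw [smul_eq_mul, mul_pow]; ring

/-- The **Hille-Yosida theorem**, for resolvents along a sequence of points `l n → ∞`. -/
theorem exists_isGenerator_of_resolvent {A : X →ₗ.[𝕜] X} (hA : Dense (A.domain : Set X))
    {R : ℕ → X →L[𝕜] X} {l : ℕ → ℝ} (hl : Tendsto l atTop atTop) (hlinj : Function.Injective l)
    (hR : ∀ n x, (R n x, (l n : 𝕜) • R n x - x) ∈ A.graph)
    (hR' : ∀ n x y, (x, y) ∈ A.graph → R n ((l n : 𝕜) • x - y) = x)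
    {M σ : ℝ} (hM : 0 ≤ M) (hσ : 0 < σ) (hlσ : ∀ n, 2 * σ ≤ l n)
    (hbd : ∀ n k, ‖R n ^ k‖ ≤ M * (1 / (l n - σ)) ^ k) :
    ∃ S : ℝ≥0 → X →L[𝕜] X, IsC0Semigroup S ∧ IsGenerator A S := by
  have hl0 (n : ℕ) : 0 < l n - σ := by linarith [hlσ n]
  -- The resolvent identity. Using it in both orders yields commutation, since `l n ≠ l m` for `n ≠
  -- m`.
  have hres (n m : ℕ) (z : X) :
      ((l m - l n : ℝ) : 𝕜) • R m (R n z) + R m z = R n z := by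
    have h := hR' m _ _ (hR n z)
    rw [← sub_add, ← sub_smul, map_add, map_smul] at h
    simpa using h
  have hRcomm (n m : ℕ) : Commute (R n) (R m) := by
    rcases eq_or_ne n m with rfl | hnm
    · exact Commute.refl _
    ext z
    have h1 := hres n m z
    have h2 := hres m n z
    have h3 : ((l m - l n : ℝ) : 𝕜) • (R m (R n z) - R n (R m z)) = 0 := by
      have e : ((l n - l m : ℝ) : 𝕜) = - ((l m - l n : ℝ) : 𝕜) := by push_cast; ring
      rw [e, neg_smul] at h2
      rw [smul_sub, eq_sub_of_add_eq h1, ← sub_eq_zero.2 h2]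
      abel
    have h4 : ((l m - l n : ℝ) : 𝕜) ≠ 0 := by
      exact_mod_cast sub_ne_zero.2 (fun h => hnm (hlinj h).symm)
    exact (sub_eq_zero.1 ((smul_eq_zero.1 h3).resolve_left h4)).symm
  have hRn (n : ℕ) : ‖R n‖ ≤ M * (1 / (l n - σ)) := by simpa using hbd n 1
  have hR0 : Tendsto (fun n => M * (1 / (l n - σ))) atTop (𝓝 0) := by
    have h1 : Tendsto (fun n => l n - σ) atTop atTop := tendsto_atTop_add_const_right _ _ hl
    simpa using h1.inv_tendsto_atTop.const_mul M
  have hdom {x y : X} (h : (x, y) ∈ A.graph) (n : ℕ) : (l n : 𝕜) • R n x - x = R n y := by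
    have := hR' n x y h
    rw [map_sub, map_smul] at this
    rw [sub_eq_iff_eq_add] at this ⊢
    rw [this, add_comm]
  -- The assumption `2 σ ≤ l n` serves to make `l n / (l n - σ) ≤ 2`.
  have hlR (n : ℕ) (x : X) : ‖(l n : 𝕜) • R n x‖ ≤ 2 * M * ‖x‖ := by
    have h1 : l n * (1 / (l n - σ)) ≤ 2 := by
      rw [mul_one_div, div_le_iff₀ (hl0 n)]; linarith [hlσ n]
    rw [norm_smul, RCLike.norm_ofReal, abs_of_nonneg (by linarith [hl0 n])]
    calc l n * ‖R n x‖ ≤ l n * (M * (1 / (l n - σ)) * ‖x‖) := by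
          have : 0 ≤ l n := by linarith [hl0 n]
          gcongr
          exact (R n).le_of_opNorm_le (hRn n) x
      _ = (l n * (1 / (l n - σ))) * (M * ‖x‖) := by ring
      _ ≤ 2 * (M * ‖x‖) := by gcongr
      _ = 2 * M * ‖x‖ := by ring
  have hlR1 (y : X) : Tendsto (fun n => (l n : 𝕜) • R n y) atTop (𝓝 y) := by
    rw [Metric.tendsto_nhds]
    intro ε hε
    obtain ⟨x', hx', hd⟩ := Metric.mem_closure_iff.1 (hA y) (ε / (2 * (2 * M + 1)))
      (by positivity)
    have hg := A.mem_graph ⟨x', hx'⟩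
    have hz := hR0.mul_const ‖A ⟨x', hx'⟩‖
    rw [zero_mul] at hz
    filter_upwards [hz.eventually_lt_const (half_pos hε)] with n hn
    rw [dist_eq_norm] at hd ⊢
    have e : (l n : 𝕜) • R n y - y = (l n : 𝕜) • R n (y - x') - (y - x')
        + ((l n : 𝕜) • R n x' - x') := by rw [map_sub, smul_sub]; abel
    have h1 := hlR n (y - x')
    have h2 : ‖(l n : 𝕜) • R n x' - x'‖ < ε / 2 := by
      rw [hdom hg n]
      exact ((R n).le_of_opNorm_le (hRn n) _).trans_lt hn
    have h3 : (2 * M + 1) * ‖y - x'‖ < ε / 2 := by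
      rw [lt_div_iff₀ (by positivity)] at hd
      linarith
    rw [e]
    refine (norm_add_le _ _).trans_lt ?_
    have := norm_sub_le ((l n : 𝕜) • R n (y - x')) (y - x')
    linarith
  -- The Yosida approximations `l² R - l = l A R`. On `D(A)` they equal `l R A`, and `l R → 1`
  -- strongly.
  refine exists_isGenerator_of_tendsto (B := fun n =>
    (((l n) ^ 2 : ℝ) : 𝕜) • R n - (l n : 𝕜) • ContinuousLinearMap.id 𝕜 X) (C := M) (σ := 2 * σ)
    hA (fun n m => ?_) hM (by positivity) (fun n t ht => ?_) (fun x y h => ?_) (hR 0)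
    (fun n => ?_)
  · have h1 (r : 𝕜) (Z : X →L[𝕜] X) : Commute (r • ContinuousLinearMap.id 𝕜 X) Z :=
      (Commute.one_left Z).smul_left r
    exact ((((hRcomm n m).smul_left _).smul_right _).sub_right ((h1 _ _).symm)).sub_left (h1 _ _)
  · have hP (k : ℕ) : ‖R n ^ k‖ ≤ M * (1 / (l n - σ)) ^ k := hbd n k
    have h1 := norm_exp_smul_le_of_norm_pow_le (𝕜 := 𝕜) hP
      (s := t * (l n) ^ 2) (by positivity)
    have e : (t : 𝕜) • ((((l n) ^ 2 : ℝ) : 𝕜) • R n - (l n : 𝕜) • ContinuousLinearMap.id 𝕜 X)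
        = ((t * (l n) ^ 2 : ℝ) : 𝕜) • R n
          + ((-(t * l n) : ℝ) : 𝕜) • (1 : X →L[𝕜] X) := by
      rw [smul_sub, smul_smul, smul_smul]
      push_cast
      rw [neg_smul, sub_eq_add_neg]
      rfl
    have h2 : ‖NormedSpace.exp (((-(t * l n) : ℝ) : 𝕜) • (1 : X →L[𝕜] X))‖
        ≤ 1 * Real.exp (-(t * l n)) := by
      rw [← Algebra.algebraMap_eq_smul_one, ← NormedSpace.algebraMap_exp_comm (𝕂 := 𝕜),
        Algebra.algebraMap_eq_smul_one, norm_smul, mul_comm]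
      refine mul_le_mul ContinuousLinearMap.norm_id_le (le_of_eq ?_) (norm_nonneg _) zero_le_one
      have h3 := NormedSpace.algebraMap_exp_comm (𝕂 := ℝ) (𝔸 := 𝕜) (-(t * l n))
      rw [RCLike.algebraMap_eq_ofReal] at h3
      rw [← h3, RCLike.norm_ofReal, ← Real.exp_eq_exp_ℝ, abs_of_pos (Real.exp_pos _)]
    rw [e, exp_add_of_commute_clm ((Commute.one_right _).smul_right _)]
    -- The growth of order `t l` from `exp (t l² R)` is cancelled by the scalar factor `exp (-t l)`;
    -- what remains is `t σ l / (l - σ)`.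
    have h3 : t * (l n) ^ 2 * (1 / (l n - σ)) + -(t * l n) ≤ 2 * σ * t := by
      have : t * (l n) ^ 2 * (1 / (l n - σ)) + -(t * l n) = t * ((l n * σ) / (l n - σ)) := by
        have := (hl0 n).ne'
        field_simp
        ring
      rw [this, mul_comm]
      refine mul_le_mul_of_nonneg_right ?_ ht
      rw [div_le_iff₀ (hl0 n)]
      nlinarith [hlσ n]
    calc _ ≤ (M * Real.exp (t * (l n) ^ 2 * (1 / (l n - σ)))) * (1 * Real.exp (-(t * l n))) :=
          (norm_mul_le _ _).trans (mul_le_mul h1 h2 (norm_nonneg _) (by positivity))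
      _ = M * Real.exp (t * (l n) ^ 2 * (1 / (l n - σ)) + -(t * l n)) := by
          rw [Real.exp_add]; ring
      _ ≤ M * Real.exp (2 * σ * t) := by gcongr
  · refine (hlR1 y).congr fun n => ?_
    rw [← hdom h n, smul_sub, smul_smul]
    simp [sq]
  · exact (((hRcomm 0 n)).smul_right _).sub_right ((Commute.one_right _).smul_right _)

end approximation

/-! ### Coercive operators and the Lumer-Phillips theorem in an equivalent inner product -/

section dissipative

open RCLike

variable {𝕜 X : Type*} [RCLike 𝕜] [NormedAddCommGroup X] [InnerProductSpace 𝕜 X]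

/-- The Lax-Milgram argument: coercivity gives `m ‖x‖ ≤ ‖T x‖`, so the range is closed, and a vector
`w` orthogonal to it satisfies `⟨T w, w⟩ = 0`, hence vanishes. -/
theorem surjective_of_coercive [CompleteSpace X] {T : X →L[𝕜] X} {m : ℝ} (hm : 0 < m)
    (h : ∀ x, m * ‖x‖ ^ 2 ≤ re (inner 𝕜 (T x) x)) : Function.Surjective T := by
  have hb (x : X) : m * ‖x‖ ≤ ‖T x‖ := by
    rcases eq_or_ne x 0 with rfl | hx
    · simp
    have hx' : 0 < ‖x‖ := norm_pos_iff.2 hx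
    have h1 := (h x).trans ((re_le_norm _).trans (norm_inner_le_norm (T x) x))
    nlinarith
  have ha : AntilipschitzWith (m⁻¹).toNNReal T := by
    refine T.antilipschitz_of_bound fun x => ?_
    rw [Real.coe_toNNReal _ (inv_nonneg.2 hm.le), ← div_eq_inv_mul, le_div_iff₀ hm]
    linarith [hb x]
  have hc : IsClosed (T.range : Set X) := ha.isClosed_range T.uniformContinuous
  have := hc.completeSpace_coe
  have htop : T.range = ⊤ := by
    rw [← (T.range).orthogonal_orthogonal, Submodule.eq_top_iff']
    intro v w hw
    have h0 := h w
    rw [(Submodule.mem_orthogonal _ _).1 hw (T w) ⟨w, rfl⟩, map_zero] at h0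
    have : ‖w‖ = 0 := by
      have := norm_nonneg w
      by_contra hne
      have : 0 < ‖w‖ := lt_of_le_of_ne this (Ne.symm hne)
      have : 0 < m * ‖w‖ ^ 2 := by positivity
      linarith
    rw [norm_eq_zero.1 this, inner_zero_left]
  exact LinearMap.range_eq_top.1 htop

variable {A : X →ₗ.[𝕜] X} {G : X →L[𝕜] X} {m σ : ℝ}

/-- Quantitative dissipativity in the inner product `⟪G ·, ·⟫`. -/
theorem sq_mul_le_of_dissipative (hG : ∀ x y, inner 𝕜 (G x) y = inner 𝕜 x (G y))
    (hpos : ∀ x, 0 ≤ re (inner 𝕜 (G x) x))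
    {x y : X} (h : re (inner 𝕜 (G y) x) ≤ σ * re (inner 𝕜 (G x) x)) {l : ℝ} (hl : σ ≤ l) :
    (l - σ) ^ 2 * re (inner 𝕜 (G x) x)
      ≤ re (inner 𝕜 (G ((l : 𝕜) • x - y)) ((l : 𝕜) • x - y)) := by
  -- In the expansion of the square, the cross term is nonnegative by dissipativity and the last
  -- square by positivity of `G`.
  have e : (l : 𝕜) • x - y = ((l - σ : ℝ) : 𝕜) • x + ((σ : 𝕜) • x - y) := by
    push_cast
    module
  have hd := hpos ((σ : 𝕜) • x - y)
  have hs (u v : X) : re (inner 𝕜 (G u) v) = re (inner 𝕜 (G v) u) := by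
    rw [hG, ← inner_conj_symm, conj_re]
  have h1 : re (inner 𝕜 (G ((σ : 𝕜) • x - y)) x)
      = σ * re (inner 𝕜 (G x) x) - re (inner 𝕜 (G y) x) := by
    rw [map_sub, map_smul, inner_sub_left, inner_smul_left, conj_ofReal, map_sub, re_ofReal_mul]
  have h2 : re (inner 𝕜 (G ((l : 𝕜) • x - y)) ((l : 𝕜) • x - y))
      = (l - σ) ^ 2 * re (inner 𝕜 (G x) x)
        + 2 * (l - σ) * re (inner 𝕜 (G ((σ : 𝕜) • x - y)) x)
        + re (inner 𝕜 (G ((σ : 𝕜) • x - y)) ((σ : 𝕜) • x - y)) := by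
    rw [e]
    generalize (σ : 𝕜) • x - y = d
    rw [map_add, map_smul, inner_add_left, inner_add_right, inner_add_right, inner_smul_left,
      inner_smul_right, inner_smul_left, inner_smul_right, conj_ofReal]
    simp only [map_add, re_ofReal_mul]
    rw [hs x d]
    ring
  rw [h2]
  nlinarith [mul_nonneg (sub_nonneg.2 hl) (sub_nonneg.2 h)]

/-- The resolvent of an operator that is dissipative for an equivalent inner product. -/
theorem exists_resolvent_of_dissipative (hG : ∀ x y, inner 𝕜 (G x) y = inner 𝕜 x (G y))
    (hm : 0 < m) (hcoer : ∀ x, m * ‖x‖ ^ 2 ≤ re (inner 𝕜 (G x) x))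
    (hdiss : ∀ x y, (x, y) ∈ A.graph → re (inner 𝕜 (G y) x) ≤ σ * re (inner 𝕜 (G x) x))
    {l : ℝ} (hl : σ < l) (hsurj : ∀ z, ∃ x y, (x, y) ∈ A.graph ∧ (l : 𝕜) • x - y = z) :
    ∃ R : X →L[𝕜] X, (∀ x, (R x, (l : 𝕜) • R x - x) ∈ A.graph) ∧
      (∀ x y, (x, y) ∈ A.graph → R ((l : 𝕜) • x - y) = x) ∧
      ∀ k, ‖R ^ k‖ ≤ √(‖G‖ / m) * (1 / (l - σ)) ^ k := by
  have hpos (x : X) : 0 ≤ re (inner 𝕜 (G x) x) := (by positivity : 0 ≤ m * ‖x‖ ^ 2).trans (hcoer x)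
  have hl0 : 0 < l - σ := sub_pos.2 hl
  have hinj {x y : X} (h : (x, y) ∈ A.graph) (h0 : (l : 𝕜) • x - y = 0) : x = 0 := by
    have h1 := sq_mul_le_of_dissipative hG hpos (hdiss x y h) hl.le
    rw [h0, inner_zero_right, map_zero] at h1
    have h2 := (hcoer x)
    by_contra hx
    have : 0 < m * ‖x‖ ^ 2 := by have := norm_pos_iff.2 hx; positivity
    have : 0 < (l - σ) ^ 2 * re (inner 𝕜 (G x) x) := by
      have := this.trans_le h2
      positivity
    linarith
  have huniq {x y x' y' : X} (h : (x, y) ∈ A.graph) (h' : (x', y') ∈ A.graph)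
      (he : (l : 𝕜) • x - y = (l : 𝕜) • x' - y') : x = x' := by
    refine sub_eq_zero.1 (hinj (A.graph.sub_mem h h') ?_)
    rw [← sub_eq_zero.2 he]
    simp only [smul_sub]
    abel
  choose r s hrs hrz using hsurj
  let R₀ : X →ₗ[𝕜] X :=
    { toFun := r
      map_add' := fun z z' => huniq (hrs _) (A.graph.add_mem (hrs z) (hrs z')) (by
        rw [hrz]
        nth_rewrite 1 [← hrz z, ← hrz z']
        simp only [smul_add]
        abel)
      map_smul' := fun a z => huniq (hrs _) (A.graph.smul_mem a (hrs z)) (by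
        rw [hrz]
        nth_rewrite 1 [← hrz z]
        simp only [RingHom.id_apply, smul_sub, smul_comm a]) }
  have hstep (z : X) : (l - σ) ^ 2 * re (inner 𝕜 (G (R₀ z)) (R₀ z)) ≤ re (inner 𝕜 (G z) z) := by
    have h1 := sq_mul_le_of_dissipative hG hpos (hdiss _ _ (hrs z)) hl.le
    rwa [hrz] at h1
  -- The resolvent contracts the `G`-norm by `1 / (l - σ)`. Powers are estimated in that norm and
  -- compared with the original norm only once, so the constant `√(‖G‖ / m)` does not depend on `k`.
  have hnorm {k : ℕ} {y z : X}
      (h : ((l - σ) ^ 2) ^ k * re (inner 𝕜 (G y) y) ≤ re (inner 𝕜 (G z) z)) :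
      ‖y‖ ≤ √(‖G‖ / m) * (1 / (l - σ)) ^ k * ‖z‖ := by
    refine (sq_le_sq₀ (norm_nonneg _) (by positivity)).1 ?_
    rw [mul_pow, mul_pow, Real.sq_sqrt (by positivity)]
    have h1 : re (inner 𝕜 (G z) z) ≤ ‖G‖ * ‖z‖ ^ 2 := by
      refine (re_le_norm _).trans ((norm_inner_le_norm _ _).trans ?_)
      rw [sq, ← mul_assoc]
      exact mul_le_mul_of_nonneg_right (G.le_opNorm z) (norm_nonneg _)
    have h2 : ((l - σ) ^ 2) ^ k * (m * ‖y‖ ^ 2) ≤ ‖G‖ * ‖z‖ ^ 2 :=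
      (mul_le_mul_of_nonneg_left (hcoer y) (by positivity)).trans (h.trans h1)
    have h3 : ‖y‖ ^ 2 ≤ (‖G‖ * ‖z‖ ^ 2) / (((l - σ) ^ 2) ^ k * m) := by
      rw [le_div_iff₀ (by positivity)]
      linarith
    refine h3.trans (le_of_eq ?_)
    rw [one_div, inv_pow, inv_pow, ← pow_mul, ← pow_mul, mul_comm 2 k]
    field_simp
  let R : X →L[𝕜] X := R₀.mkContinuous (√(‖G‖ / m) * (1 / (l - σ)) ^ 1) fun z =>
    hnorm (k := 1) (by simpa using hstep z)
  refine ⟨R, fun x => ?_, fun x y h => ?_, fun k => ?_⟩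
  · have : (l : 𝕜) • r x - x = s x := by
      nth_rewrite 2 [← hrz x]
      abel
    change (r x, (l : 𝕜) • r x - x) ∈ A.graph
    rw [this]
    exact hrs x
  · exact huniq (hrs _) h (hrz _)
  · refine ContinuousLinearMap.opNorm_le_bound _ (by positivity) fun z => hnorm ?_
    induction k with
    | zero => simp
    | succ k ih =>
      have e : (R ^ (k + 1)) z = R₀ ((R ^ k) z) := by rw [pow_succ']; rfl
      rw [e, pow_succ, mul_assoc]
      exact (mul_le_mul_of_nonneg_left (hstep _) (by positivity)).trans ih

/-- The **Lumer-Phillips theorem** for an equivalent inner product `⟪G ·, ·⟫` on a Hilbert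
space. -/
theorem exists_isGenerator_of_dissipative [CompleteSpace X]
    (hG : ∀ x y, inner 𝕜 (G x) y = inner 𝕜 x (G y))
    (hm : 0 < m) (hcoer : ∀ x, m * ‖x‖ ^ 2 ≤ re (inner 𝕜 (G x) x)) (hσ : 0 < σ)
    (hdiss : ∀ x y, (x, y) ∈ A.graph → re (inner 𝕜 (G y) x) ≤ σ * re (inner 𝕜 (G x) x))
    {l₀ : ℝ} (hsurj : ∀ l : ℝ, l₀ ≤ l → ∀ z, ∃ x y, (x, y) ∈ A.graph ∧ (l : 𝕜) • x - y = z) :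
    ∃ S : ℝ≥0 → X →L[𝕜] X, IsC0Semigroup S ∧ IsGenerator A S := by
  let l : ℕ → ℝ := fun n => max l₀ (2 * σ) + n
  have hl0 (n : ℕ) : l₀ ≤ l n := by
    have := le_max_left l₀ (2 * σ)
    have : (0 : ℝ) ≤ n := n.cast_nonneg
    simp only [l]
    linarith
  have hlσ (n : ℕ) : 2 * σ ≤ l n := by
    have := le_max_right l₀ (2 * σ)
    have : (0 : ℝ) ≤ n := n.cast_nonneg
    simp only [l]
    linarith
  have hres (n : ℕ) := exists_resolvent_of_dissipative hG hm hcoer hdiss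
    (by linarith [hlσ n] : σ < l n) (hsurj (l n) (hl0 n))
  choose R hR1 hR2 hR3 using hres
  have hdense : Dense (A.domain : Set X) := by
    rw [Submodule.dense_iff_topologicalClosure_eq_top, Submodule.topologicalClosure_eq_top_iff,
      Submodule.eq_bot_iff]
    intro z hz
    -- Density: a vector orthogonal to `D(A)` has the form `G (l x - y)` with `y = A x`. Testing it
    -- with `x` gives `l ⟨G x, x⟩ = re ⟨G y, x⟩ ≤ σ ⟨G x, x⟩`, which forces `x = 0` as `l > σ`.
    obtain ⟨z', rfl⟩ := surjective_of_coercive hm hcoer z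
    obtain ⟨x, y, hxy, hz'⟩ := hsurj (l 0) (hl0 0) z'
    have h0 := (Submodule.mem_orthogonal _ _).1 hz x (A.mem_domain_iff.2 ⟨y, hxy⟩)
    have hs : re (inner 𝕜 (G x) y) = re (inner 𝕜 (G y) x) := by
      rw [hG, ← inner_conj_symm, conj_re]
    have h1 : l 0 * re (inner 𝕜 (G x) x) - re (inner 𝕜 (G y) x) = 0 := by
      rw [← hG, ← hz', inner_sub_right, inner_smul_right] at h0
      have := congrArg re h0
      rwa [map_sub, re_ofReal_mul, hs, map_zero] at this
    have h2 := hdiss x y hxy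
    have hx : x = 0 := by
      by_contra hx
      have h3 : 0 < re (inner 𝕜 (G x) x) := by
        have := norm_pos_iff.2 hx
        exact (by positivity : 0 < m * ‖x‖ ^ 2).trans_le (hcoer x)
      nlinarith [hlσ 0]
    have hy : y = 0 := A.graph_fst_eq_zero_snd hxy hx
    rw [← hz', hx, hy]
    simp
  exact exists_isGenerator_of_resolvent hdense
    (tendsto_atTop_add_const_left _ _ tendsto_natCast_atTop_atTop)
    (fun a b h => by simpa [l] using h) hR1 hR2 (Real.sqrt_nonneg _) hσ hlσ hR3

end dissipative

/-! ### Second order equations as first order systems -/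

section wave

open RCLike ContinuousLinearMap

variable {𝕜 V H : Type*} [RCLike 𝕜] [NormedAddCommGroup V] [InnerProductSpace 𝕜 V]
  [NormedAddCommGroup H] [InnerProductSpace 𝕜 H]

/-- The operator `(u, v) ↦ (T u, v)` on `V × H`. -/
def prodId (H : Type*) [NormedAddCommGroup H] [InnerProductSpace 𝕜 H] (T : V →L[𝕜] V) :
    WithLp 2 (V × H) →L[𝕜] WithLp 2 (V × H) :=
  (WithLp.prodContinuousLinearEquiv 2 𝕜 V H).symm.toContinuousLinearMap ∘L
    (T.prodMap (ContinuousLinearMap.id 𝕜 H)) ∘L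
    (WithLp.prodContinuousLinearEquiv 2 𝕜 V H).toContinuousLinearMap

theorem inner_prodId (T : V →L[𝕜] V) (x y : WithLp 2 (V × H)) :
    inner 𝕜 (prodId H T x) y = inner 𝕜 (T x.fst) y.fst + inner 𝕜 x.snd y.snd :=
  rfl

theorem inner_prodId_right (T : V →L[𝕜] V) (x y : WithLp 2 (V × H)) :
    inner 𝕜 x (prodId H T y) = inner 𝕜 x.fst (T y.fst) + inner 𝕜 x.snd y.snd :=
  rfl

/-- The first order system `(u, v)' = (v, -W u)` of a wave equation `u'' = -W u`, where `W` is the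
operator in `H` of a symmetric form `⟪T ·, ·⟫` on a Hilbert space `V` embedded in `H` by `I`,
generates a `C₀`-semigroup on `V × H` if the form satisfies a Gårding inequality. -/
theorem exists_isGenerator_wave [CompleteSpace V] [CompleteSpace H] {I : V →L[𝕜] H} {T : V →L[𝕜] V}
    (hT : ∀ u v, inner 𝕜 (T u) v = inner 𝕜 u (T v)) {m K : ℝ} (hm : 0 < m) (hK : 0 ≤ K)
    (hcoer : ∀ u, m * ‖u‖ ^ 2 ≤ re (inner 𝕜 (T u) u) + K * ‖I u‖ ^ 2)
    {A : WithLp 2 (V × H) →ₗ.[𝕜] WithLp 2 (V × H)}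
    (hA : ∀ x y, (x, y) ∈ A.graph ↔ I y.fst = x.snd ∧ T x.fst = -adjoint I y.snd) :
    ∃ S : ℝ≥0 → WithLp 2 (V × H) →L[𝕜] WithLp 2 (V × H), IsC0Semigroup S ∧ IsGenerator A S := by
  let Tk (k : ℝ) : V →L[𝕜] V := T + (k : 𝕜) • (adjoint I ∘L I)
  have hTk (k : ℝ) (u v : V) : inner 𝕜 (Tk k u) v = inner 𝕜 (T u) v + k * inner 𝕜 (I u) (I v) := by
    simp [Tk, inner_add_left, inner_smul_left, adjoint_inner_left]
  have hTk' (k : ℝ) (u v : V) : inner 𝕜 u (Tk k v) = inner 𝕜 (T u) v + k * inner 𝕜 (I u) (I v) := by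
    simp [Tk, inner_add_right, inner_smul_right, adjoint_inner_right, hT]
  have hself (k : ℝ) (u : V) : re (inner 𝕜 (Tk k u) u) = re (inner 𝕜 (T u) u) + k * ‖I u‖ ^ 2 := by
    rw [hTk, map_add, re_ofReal_mul, inner_self_eq_norm_sq]
  set μ := min m 1
  have hμ0 : 0 < μ := lt_min hm one_pos
  have hGcoer (x : WithLp 2 (V × H)) : μ * ‖x‖ ^ 2 ≤ re (inner 𝕜 (prodId H (Tk K) x) x) := by
    rw [inner_prodId, map_add, hself, inner_self_eq_norm_sq, WithLp.prod_norm_sq_eq_of_L2, mul_add]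
    have h1 : μ * ‖x.fst‖ ^ 2 ≤ m * ‖x.fst‖ ^ 2 := by gcongr; exact min_le_left _ _
    have h2 : μ * ‖x.snd‖ ^ 2 ≤ 1 * ‖x.snd‖ ^ 2 := by gcongr; exact min_le_right _ _
    linarith [hcoer x.fst]
  -- The `+ 1` in `σ` secures `0 < σ` even when `K ‖I‖ = 0`; `l₀ = K + 1` ensures `K ≤ l²` for all
  -- `l ≥ l₀`.
  refine exists_isGenerator_of_dissipative (G := prodId H (Tk K)) (m := μ)
    (σ := K * ‖I‖ / μ + 1) (l₀ := K + 1)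
    (fun x y => by rw [inner_prodId, inner_prodId_right, hTk, hTk']) hμ0 hGcoer (by positivity)
    (fun x y h => ?_) (fun l hl z => ?_)
  · obtain ⟨h1, h2⟩ := (hA x y).1 h
    have e : re (inner 𝕜 (prodId H (Tk K) y) x) = K * re (inner 𝕜 x.snd (I x.fst)) := by
      rw [inner_prodId, hTk, hT, h2, inner_neg_right, adjoint_inner_right, h1, map_add, map_add,
        re_ofReal_mul, map_neg, ← inner_conj_symm y.snd x.snd, conj_re]
      ring
    have hx1 : ‖x.snd‖ ≤ ‖x‖ := WithLp.norm_snd_le _ x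
    have hx2 : ‖x.fst‖ ≤ ‖x‖ := WithLp.norm_fst_le _ x
    have e2 : re (inner 𝕜 x.snd (I x.fst)) ≤ ‖I‖ * ‖x‖ ^ 2 := by
      refine (re_le_norm _).trans ((norm_inner_le_norm _ _).trans ?_)
      calc ‖x.snd‖ * ‖I x.fst‖ ≤ ‖x‖ * (‖I‖ * ‖x‖) :=
            mul_le_mul hx1 ((I.le_opNorm _).trans (by gcongr)) (norm_nonneg _) (norm_nonneg _)
        _ = ‖I‖ * ‖x‖ ^ 2 := by ring
    have e3 : K * ‖I‖ * ‖x‖ ^ 2 ≤ K * ‖I‖ / μ * re (inner 𝕜 (prodId H (Tk K) x) x) := by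
      calc K * ‖I‖ * ‖x‖ ^ 2 = K * ‖I‖ / μ * (μ * ‖x‖ ^ 2) := by field_simp
        _ ≤ _ := by gcongr; exact hGcoer x
    have e4 : 0 ≤ re (inner 𝕜 (prodId H (Tk K) x) x) :=
      (by positivity : 0 ≤ μ * ‖x‖ ^ 2).trans (hGcoer x)
    have e5 := mul_le_mul_of_nonneg_left e2 hK
    rw [e]
    linarith
  · have hl' : K ≤ l ^ 2 := by nlinarith
    -- Eliminating `v = I (l u - z₁)` from the resolvent system leaves `T u + l² I* I u = I* (z₂ + l
    -- I z₁)`.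
    obtain ⟨u, hu⟩ := surjective_of_coercive (T := Tk (l ^ 2)) hm (fun u => by
      rw [hself]
      have : K * ‖I u‖ ^ 2 ≤ l ^ 2 * ‖I u‖ ^ 2 := by gcongr
      linarith [hcoer u]) (adjoint I (z.snd + (l : 𝕜) • I z.fst))
    refine ⟨WithLp.toLp 2 (u, I ((l : 𝕜) • u - z.fst)),
      WithLp.toLp 2 ((l : 𝕜) • u - z.fst, (l : 𝕜) • I ((l : 𝕜) • u - z.fst) - z.snd),
      (hA _ _).2 ⟨rfl, ?_⟩, ?_⟩
    · have hu' : T u = adjoint I (z.snd + (l : 𝕜) • I z.fst)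
          - ((l ^ 2 : ℝ) : 𝕜) • adjoint I (I u) := eq_sub_of_add_eq hu
      change T u = -adjoint I ((l : 𝕜) • I ((l : 𝕜) • u - z.fst) - z.snd)
      rw [hu']
      simp only [map_add, map_sub, map_smul, smul_sub, smul_smul, sq, ofReal_mul]
      abel
    · apply WithLp.ofLp_injective 2
      exact Prod.ext (sub_sub_cancel _ _) (sub_sub_cancel _ _)

end wave

/-! ### Primitives, weak derivatives and integration by parts on the half-line -/

section primitive

variable {𝕜 : Type*} [RCLike 𝕜]

theorem intervalIntegrable_of_locallyIntegrable {f : ℝ → 𝕜} (hf : LocallyIntegrable f volume)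
    (a b : ℝ) : IntervalIntegrable f volume a b :=
  intervalIntegrable_iff.2
    ((hf.integrableOn_isCompact isCompact_uIcc).mono_set uIoc_subset_uIcc)

/-- Each increment is dominated by the corresponding increment of the real primitive of `‖f‖`. -/
theorem absolutelyContinuousOnInterval_integral {f : ℝ → 𝕜} (hf : LocallyIntegrable f volume)
    (a b : ℝ) : AbsolutelyContinuousOnInterval (fun x => ∫ t in a..x, f t) a b := by
  have hi (c d : ℝ) := intervalIntegrable_of_locallyIntegrable hf c d
  have h := (hi a b).norm.absolutelyContinuousOnInterval_intervalIntegral (c := a) left_mem_uIcc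
  refine squeeze_zero (fun _ => Finset.sum_nonneg fun _ _ => dist_nonneg) (fun E => ?_) h
  refine Finset.sum_le_sum fun i _ => ?_
  rw [dist_comm, dist_eq_norm, dist_comm, Real.dist_eq,
    intervalIntegral.integral_interval_sub_left (hi _ _) (hi _ _),
    intervalIntegral.integral_interval_sub_left (hi _ _).norm (hi _ _).norm]
  exact intervalIntegral.norm_integral_le_abs_integral_norm

/-- The product rule for primitives of locally integrable functions. -/
theorem integral_mul_add_mul_primitive {w z : ℝ → 𝕜} (hw : LocallyIntegrable w volume)
    (hz : LocallyIntegrable z volume) (a b : 𝕜) (T : ℝ) :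
    ∫ x in 0..T, (w x * (b + ∫ t in 0..x, z t) + (a + ∫ t in 0..x, w t) * z x)
      = (a + ∫ t in 0..T, w t) * (b + ∫ t in 0..T, z t) - a * b := by
  have hcw : Continuous fun x => a + ∫ t in 0..x, w t := continuous_const.add
    (intervalIntegral.continuous_primitive (intervalIntegrable_of_locallyIntegrable hw) 0)
  have hcz : Continuous fun x => b + ∫ t in 0..x, z t := continuous_const.add
    (intervalIntegral.continuous_primitive (intervalIntegrable_of_locallyIntegrable hz) 0)
  have hloc : LocallyIntegrable
      (fun x => w x * (b + ∫ t in 0..x, z t) + (a + ∫ t in 0..x, w t) * z x) volume := by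
    refine LocallyIntegrable.add ?_ ?_
    · exact locallyIntegrableOn_univ.1 <| (hw.locallyIntegrableOn univ).mul_continuousOn hcz.continuousOn
        isOpen_univ.isLocallyClosed
    · exact locallyIntegrableOn_univ.1 <| (hz.locallyIntegrableOn univ).continuousOn_mul hcw.continuousOn
        isOpen_univ.isLocallyClosed
  have hconst (c : 𝕜) : AbsolutelyContinuousOnInterval (fun _ => c) 0 T := by
    simpa [AbsolutelyContinuousOnInterval] using tendsto_const_nhds
  -- The product minus the primitive of its expected derivative is absolutely continuous with
  -- derivative zero almost everywhere, hence constant; its values at `0` and `T` are compared.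
  have hac := ((((hconst a).add (absolutelyContinuousOnInterval_integral hw 0 T)).smul
    ((hconst b).add (absolutelyContinuousOnInterval_integral hz 0 T))).sub
      (absolutelyContinuousOnInterval_integral hloc 0 T))
  obtain ⟨C, hC⟩ := hac.const_of_ae_hasDerivAt_zero (by
    filter_upwards [_root_.LocallyIntegrable.ae_hasDerivAt_integral hw, _root_.LocallyIntegrable.ae_hasDerivAt_integral hz,
      _root_.LocallyIntegrable.ae_hasDerivAt_integral hloc] with x h1 h2 h3 _
    have := (((h1 0).const_add a).mul ((h2 0).const_add b)).sub (h3 0)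
    rw [sub_self] at this
    exact this)
  have h0 : (a + ∫ t in 0..0, w t) * (b + ∫ t in 0..0, z t) - ∫ x in 0..0,
      (w x * (b + ∫ t in 0..x, z t) + (a + ∫ t in 0..x, w t) * z x) = C := hC 0 left_mem_uIcc
  have hT : (a + ∫ t in 0..T, w t) * (b + ∫ t in 0..T, z t) - ∫ x in 0..T,
      (w x * (b + ∫ t in 0..x, z t) + (a + ∫ t in 0..x, w t) * z x) = C := hC T right_mem_uIcc
  simp only [intervalIntegral.integral_same, add_zero, sub_zero] at h0
  rw [h0, ← hT, sub_sub_cancel]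

/-- The primitive on `(0, ∞)`, vanishing at `0`, of a function on `(0, ∞)`. -/
noncomputable def primitive (f : ℝ → 𝕜) (x : ℝ) : 𝕜 := ∫ t in 0..x, (Ioi (0 : ℝ)).indicator f t

theorem locallyIntegrable_indicator {f : ℝ → 𝕜} (hf : MemLp f 2 (volume.restrict (Ioi (0 : ℝ)))) :
    LocallyIntegrable ((Ioi (0 : ℝ)).indicator f) volume :=
  ((memLp_indicator_iff_restrict measurableSet_Ioi).2 hf).locallyIntegrable (by norm_num)

theorem continuous_primitive {f : ℝ → 𝕜} (hf : MemLp f 2 (volume.restrict (Ioi (0 : ℝ)))) :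
    Continuous (primitive f) :=
  intervalIntegral.continuous_primitive
    (intervalIntegrable_of_locallyIntegrable (locallyIntegrable_indicator hf)) 0

theorem primitive_zero (f : ℝ → 𝕜) : primitive f 0 = 0 := intervalIntegral.integral_same

theorem primitive_congr {f g : ℝ → 𝕜} (h : f =ᵐ[volume.restrict (Ioi (0 : ℝ))] g) :
    primitive f = primitive g := by
  ext x
  refine intervalIntegral.integral_congr_ae ?_
  filter_upwards [(ae_restrict_iff' measurableSet_Ioi).1 h] with t ht _
  by_cases h0 : t ∈ Ioi (0 : ℝ)
  · rw [indicator_of_mem h0, indicator_of_mem h0, ht h0]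
  · rw [indicator_of_notMem h0, indicator_of_notMem h0]

theorem primitive_conj (f : ℝ → 𝕜) (x : ℝ) :
    primitive (fun t => starRingEnd 𝕜 (f t)) x = starRingEnd 𝕜 (primitive f x) := by
  have e : (Ioi (0 : ℝ)).indicator (fun t => starRingEnd 𝕜 (f t))
      = fun t => starRingEnd 𝕜 ((Ioi (0 : ℝ)).indicator f t) := by
    ext t
    by_cases ht : t ∈ Ioi (0 : ℝ) <;> simp [ht]
  rw [primitive, primitive, e]
  simp only [intervalIntegral, integral_conj, map_sub]

theorem integral_ofReal_deriv {g g' : ℝ → ℝ} (hg : ∀ x, HasDerivAt g (g' x) x)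
    (hc : Continuous g') (a b : ℝ) :
    ∫ t in a..b, (g' t : 𝕜) = (g b : 𝕜) - (g a : 𝕜) :=
  intervalIntegral.integral_eq_sub_of_hasDerivAt
    (fun y _ => (RCLike.ofRealCLM (K := 𝕜)).hasFDerivAt.comp_hasDerivAt y (hg y))
    ((RCLike.continuous_ofReal.comp hc).intervalIntegrable _ _)

theorem primitive_deriv {g g' : ℝ → ℝ} (hg : ∀ x, HasDerivAt g (g' x) x) (hc : Continuous g')
    {x : ℝ} (hx : 0 ≤ x) :
    primitive (fun t => (g' t : 𝕜)) x = (g x : 𝕜) - (g 0 : 𝕜) := by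
  have e : primitive (fun t => (g' t : 𝕜)) x = ∫ t in 0..x, (g' t : 𝕜) := by
    rw [primitive, intervalIntegral.integral_of_le hx, intervalIntegral.integral_of_le hx]
    refine setIntegral_congr_fun measurableSet_Ioc fun t ht => ?_
    exact indicator_of_mem (mem_Ioi.2 ht.1) _
  rw [e, integral_ofReal_deriv hg hc]

theorem exists_subset_Icc_of_isCompact {K : Set ℝ} (hK : IsCompact K) (h : K ⊆ Ioi 0) :
    ∃ a b : ℝ, 0 < a ∧ a ≤ b ∧ K ⊆ Icc a b := by
  rcases K.eq_empty_or_nonempty with rfl | hne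
  · exact ⟨1, 1, one_pos, le_rfl, empty_subset _⟩
  obtain ⟨a, ha, ha'⟩ := hK.exists_isLeast hne
  obtain ⟨b, hb, hb'⟩ := hK.exists_isGreatest hne
  exact ⟨a, b, h ha, ha' hb, fun x hx => ⟨ha' hx, hb' hx⟩⟩

/-- Primitives are weak antiderivatives. -/
theorem integral_deriv_smul_primitive {w : ℝ → 𝕜}
    (hw : MemLp w 2 (volume.restrict (Ioi (0 : ℝ)))) (a : 𝕜) {η : ℝ → ℝ} (hη : ContDiff ℝ ∞ η)
    (hs : HasCompactSupport η) (ht : tsupport η ⊆ Ioi 0) :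
    ∫ x in Ioi (0 : ℝ), deriv η x • (a + primitive w x) = -∫ x in Ioi (0 : ℝ), η x • w x := by
  obtain ⟨α, β, hα, hαβ, hK⟩ := exists_subset_Icc_of_isCompact hs ht
  have hη0 {x : ℝ} (hx : x ∉ Icc α β) : η x = 0 := image_eq_zero_of_notMem_tsupport fun h => hx (hK h)
  have hη0' {x : ℝ} (hx : x ∉ Icc α β) : deriv η x = 0 := by
    by_contra h
    exact hx (hK (support_deriv_subset h))
  have hT : (0 : ℝ) ≤ β + 1 := by linarith
  have hsub : Ioc 0 (β + 1) ⊆ Ioi (0 : ℝ) := fun x hx => hx.1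
  have hred {F : ℝ → 𝕜} (hF : ∀ x, x ∉ Icc α β → F x = 0) :
      ∫ x in Ioi (0 : ℝ), F x = ∫ x in 0..(β + 1), F x := by
    rw [intervalIntegral.integral_of_le hT]
    refine (setIntegral_eq_of_subset_of_forall_sdiff_eq_zero measurableSet_Ioi hsub ?_)
    exact fun x hx => hF x fun h => hx.2 ⟨hx.1, by linarith [h.2]⟩
  have hd : Continuous (deriv η) := hη.continuous_deriv (by simp)
  have hdη (x : ℝ) : HasDerivAt η (deriv η x) x :=
    (hη.differentiable (by simp) x).hasDerivAt
  have hloc : LocallyIntegrable (fun x => ((deriv η x : ℝ) : 𝕜)) volume :=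
    (RCLike.continuous_ofReal.comp hd).locallyIntegrable
  -- The product rule for `a + ∫ w` and `η = ∫ η'`. Both boundary terms vanish, as `0` and `β + 1`
  -- lie outside the support of `η`.
  have hprod := integral_mul_add_mul_primitive (locallyIntegrable_indicator hw) hloc a 0 (β + 1)
  have hprim (x : ℝ) : ∫ t in 0..x, ((deriv η t : ℝ) : 𝕜) = (η x : 𝕜) := by
    rw [integral_ofReal_deriv hdη hd, hη0 (x := 0) (fun h => by linarith [h.1]),
      RCLike.ofReal_zero, sub_zero]
  simp only [zero_add, hprim] at hprod
  rw [hη0 (x := β + 1) (fun h => by linarith [h.2]), RCLike.ofReal_zero, mul_zero, mul_zero,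
    sub_zero] at hprod
  rw [hred (fun x hx => by rw [hη0' hx, zero_smul]), hred (fun x hx => by rw [hη0 hx, zero_smul]),
    eq_neg_iff_add_eq_zero, ← intervalIntegral.integral_add, ← hprod]
  · rw [intervalIntegral.integral_of_le hT, intervalIntegral.integral_of_le hT]
    refine setIntegral_congr_fun measurableSet_Ioc fun x hx => ?_
    simp only [RCLike.real_smul_eq_coe_mul, indicator_of_mem (mem_Ioi.2 hx.1), primitive]
    ring
  · exact (hd.smul (continuous_const.add (continuous_primitive hw))).intervalIntegrable _ _
  · have h1 : IntervalIntegrable ((Ioi (0 : ℝ)).indicator w) volume 0 (β + 1) :=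
      intervalIntegrable_of_locallyIntegrable (locallyIntegrable_indicator hw) _ _
    have h2 := h1.continuousOn_smul (f := η) hη.continuous.continuousOn
    refine h2.congr fun x hx => ?_
    rw [uIoc_of_le hT] at hx
    simp only [indicator_of_mem (mem_Ioi.2 hx.1)]

/-- **Du Bois-Reymond lemma** on the half-line. -/
theorem exists_ae_eq_const_of_integral_deriv_smul_eq_zero {f : ℝ → 𝕜}
    (hf : LocallyIntegrable f (volume.restrict (Ioi (0 : ℝ))))
    (h : ∀ η : ℝ → ℝ, ContDiff ℝ ∞ η → HasCompactSupport η → tsupport η ⊆ Ioi 0 →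
      ∫ x in Ioi (0 : ℝ), deriv η x • f x = 0) :
    ∃ a : 𝕜, ∀ᵐ x ∂(volume.restrict (Ioi (0 : ℝ))), f x = a := by
  -- The closed support is `[1, 3]`, inside the open half-line.
  let ρ₀ : ContDiffBump (2 : ℝ) := ⟨1 / 2, 1, by norm_num, by norm_num⟩
  let ρ : ℝ → ℝ := ρ₀.normed volume
  have hρ : ContDiff ℝ ∞ ρ := ρ₀.contDiff_normed
  have hρs : HasCompactSupport ρ := ρ₀.hasCompactSupport_normed
  have hρt : tsupport ρ ⊆ Ioi 0 := by
    rw [ρ₀.tsupport_normed_eq]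
    intro x hx
    rw [Metric.mem_closedBall, Real.dist_eq] at hx
    have : |x - 2| ≤ 1 := hx
    rw [abs_le] at this
    exact mem_Ioi.2 (by linarith)
  have hρ1 : ∫ x, ρ x = 1 := ρ₀.integral_normed
  set c : 𝕜 := ∫ x in Ioi (0 : ℝ), ρ x • f x with hc
  refine ⟨c, ?_⟩
  have hint {ζ : ℝ → ℝ} (hζ : ContDiff ℝ ∞ ζ) (hs : HasCompactSupport ζ) :
      Integrable (fun x => ζ x • f x) (volume.restrict (Ioi (0 : ℝ))) :=
    hf.integrable_smul_left_of_hasCompactSupport hζ.continuous hs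
  have hfull {ζ : ℝ → ℝ} (ht : tsupport ζ ⊆ Ioi 0) : ∫ x in Ioi (0 : ℝ), ζ x = ∫ x, ζ x :=
    setIntegral_eq_integral_of_forall_compl_eq_zero fun x hx =>
      image_eq_zero_of_notMem_tsupport fun h => hx (ht h)
  have key (ζ : ℝ → ℝ) (hζ : ContDiff ℝ ∞ ζ) (hs : HasCompactSupport ζ)
      (ht : tsupport ζ ⊆ Ioi 0) :
      ∫ x in Ioi (0 : ℝ), ζ x • f x = (∫ x, ζ x) • c := by
    set r := ∫ x, ζ x with hr
    -- Having mean zero, `ψ` is the derivative of a test function, so the hypothesis applies to it.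
    let ψ : ℝ → ℝ := fun x => ζ x - r * ρ x
    have hψ : ContDiff ℝ ∞ ψ := hζ.sub (contDiff_const.mul hρ)
    obtain ⟨α, β, hα, hαβ, hK⟩ := exists_subset_Icc_of_isCompact (hs.union hρs)
      (union_subset ht hρt)
    have hψ0 {x : ℝ} (hx : x ∉ Icc α β) : ψ x = 0 := by
      have h1 : ζ x = 0 := image_eq_zero_of_notMem_tsupport fun h => hx (hK (Or.inl h))
      have h2 : ρ x = 0 := image_eq_zero_of_notMem_tsupport fun h => hx (hK (Or.inr h))
      simp [ψ, h1, h2]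
    have hψi : ∫ x, ψ x = 0 := by
      rw [integral_sub (hζ.continuous.integrable_of_hasCompactSupport hs)
        ((hρ.continuous.integrable_of_hasCompactSupport hρs).const_mul r),
        integral_const_mul, hρ1, ← hr, mul_one, sub_self]
    let η : ℝ → ℝ := fun x => ∫ t in 0..x, ψ t
    have hη (x : ℝ) : HasDerivAt η (ψ x) x :=
      intervalIntegral.integral_hasDerivAt_right (hψ.continuous.intervalIntegrable _ _)
        hψ.continuous.stronglyMeasurable.stronglyMeasurableAtFilter hψ.continuous.continuousAt
    have hdη : deriv η = ψ := funext fun x => (hη x).deriv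
    have hηc : ContDiff ℝ ∞ η := by
      rw [contDiff_infty_iff_deriv, hdη]
      exact ⟨fun x => (hη x).differentiableAt, hψ⟩
    have hη0 {x : ℝ} (hx : x ∉ Icc α β) : η x = 0 := by
      by_cases hxα : x < α
      · refine (intervalIntegral.integral_congr (g := fun _ => 0) fun t ht => hψ0 fun h => ?_).trans
          (by simp)
        rcases le_total 0 x with h0 | h0
        · rw [uIcc_of_le h0] at ht; linarith [ht.2, h.1]
        · rw [uIcc_of_ge h0] at ht; linarith [ht.2, h.1]
      · have hxβ : β < x := by
          by_contra hh
          exact hx ⟨not_lt.1 hxα, not_lt.1 hh⟩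
        rw [← hψi]
        change ∫ t in 0..x, ψ t = _
        rw [intervalIntegral.integral_of_le (by linarith)]
        refine setIntegral_eq_integral_of_forall_compl_eq_zero fun t ht => hψ0 fun h => ht ?_
        exact ⟨by linarith [h.1], by linarith [h.2]⟩
    have hηt : tsupport η ⊆ Icc α β := by
      refine closure_minimal (fun x hx => ?_) isClosed_Icc
      by_contra hx'
      exact hx (hη0 hx')
    have h0 := h η hηc (HasCompactSupport.of_support_subset_isCompact isCompact_Icc
      ((subset_tsupport η).trans hηt)) (hηt.trans fun x hx => hα.trans_le hx.1)
    rw [hdη] at h0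
    have e : ∫ x in Ioi (0 : ℝ), ψ x • f x
        = ∫ x in Ioi (0 : ℝ), (ζ x • f x - r • (ρ x • f x)) := by
      congr 1
      ext x
      simp only [ψ, sub_smul, mul_smul]
    rw [e, integral_sub (hint hζ hs) ((hint hρ hρs).fun_smul r), integral_smul] at h0
    exact sub_eq_zero.1 h0
  have hloc : LocallyIntegrable (fun x => f x - c) (volume.restrict (Ioi (0 : ℝ))) :=
    hf.sub (locallyIntegrable_const c)
  have := isOpen_Ioi.ae_eq_zero_of_integral_contDiff_smul_eq_zero
    (hloc.locallyIntegrableOn (Ioi 0)) (fun ζ hζ hs ht => by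
      have hi : Integrable ζ (volume.restrict (Ioi (0 : ℝ))) :=
        (hζ.continuous.integrable_of_hasCompactSupport hs).restrict
      simp only [smul_sub]
      rw [integral_sub (hint hζ hs) (hi.smul_const c), key ζ hζ hs ht, integral_smul_const,
        hfull ht, sub_self])
  filter_upwards [this, ae_restrict_mem measurableSet_Ioi] with x hx hm
  exact sub_eq_zero.1 (hx hm)

/-- Functions with a weak derivative are primitives. -/
theorem HasWeakDeriv.exists_ae_eq {u w : L2 𝕜} (h : HasWeakDeriv u w) :
    ∃ a : 𝕜, ∀ᵐ x ∂(volume.restrict (Ioi (0 : ℝ))), u x = a + primitive w x := by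
  have hloc : LocallyIntegrable (fun x => u x - primitive w x)
      (volume.restrict (Ioi (0 : ℝ))) :=
    ((Lp.memLp u).locallyIntegrable (by norm_num)).sub
      (continuous_primitive (Lp.memLp w)).locallyIntegrable
  obtain ⟨a, ha⟩ := exists_ae_eq_const_of_integral_deriv_smul_eq_zero hloc
    (fun η hη hs ht => by
      have hd : Continuous (deriv η) := hη.continuous_deriv (by simp)
      have h1 := integral_deriv_smul_primitive (Lp.memLp w) 0 hη hs ht
      simp only [zero_add] at h1
      simp only [smul_sub]
      rw [integral_sub (integrable_smul_L2 u hd hs.deriv), h η hη hs ht, h1, sub_self]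
      exact ((hd.smul (continuous_primitive (Lp.memLp w))).integrable_of_hasCompactSupport
        hs.deriv.smul_right).restrict)
  refine ⟨a, ?_⟩
  filter_upwards [ha] with x hx
  rw [← hx]
  ring

theorem hasWeakDeriv_of_ae_eq {u w : L2 𝕜} {a : 𝕜}
    (h : ∀ᵐ x ∂(volume.restrict (Ioi (0 : ℝ))), u x = a + primitive w x) : HasWeakDeriv u w := by
  intro η hη hs ht
  rw [← integral_deriv_smul_primitive (Lp.memLp w) a hη hs ht]
  refine integral_congr_ae ?_
  filter_upwards [h] with x hx
  rw [hx]

/-- Integration by parts on the half-line. -/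
theorem integral_mul_add_mul_Ioi {u w v z : ℝ → 𝕜} {a b : 𝕜}
    (hu : MemLp u 2 (volume.restrict (Ioi (0 : ℝ))))
    (hw : MemLp w 2 (volume.restrict (Ioi (0 : ℝ))))
    (hv : MemLp v 2 (volume.restrict (Ioi (0 : ℝ))))
    (hz : MemLp z 2 (volume.restrict (Ioi (0 : ℝ))))
    (huw : ∀ᵐ x ∂(volume.restrict (Ioi (0 : ℝ))), u x = a + primitive w x)
    (hvz : ∀ᵐ x ∂(volume.restrict (Ioi (0 : ℝ))), v x = b + primitive z x) :
    ∫ x in Ioi (0 : ℝ), (w x * v x + u x * z x) = -(a * b) := by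
  let F : ℝ → 𝕜 := fun x => (Ioi (0 : ℝ)).indicator w x * (b + primitive z x)
    + (a + primitive w x) * (Ioi (0 : ℝ)).indicator z x
  have hF : (fun x => w x * v x + u x * z x) =ᵐ[volume.restrict (Ioi (0 : ℝ))] F := by
    filter_upwards [huw, hvz, ae_restrict_mem measurableSet_Ioi] with x h1 h2 hx
    simp only [F, h1, h2, indicator_of_mem hx]
  have hFi : IntegrableOn F (Ioi 0) :=
    ((hw.integrable_mul hv).add (hu.integrable_mul hz)).congr hF
  have hPi : IntegrableOn (fun x => (a + primitive w x) * (b + primitive z x)) (Ioi 0) := by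
    refine (hu.integrable_mul hv).congr ?_
    filter_upwards [huw, hvz] with x h1 h2
    simp only [Pi.mul_apply, h1, h2]
  have hlim := (intervalIntegral_tendsto_integral_Ioi 0 hFi tendsto_id).const_add (a * b)
  have hP : Tendsto (fun x => (a + primitive w x) * (b + primitive z x)) atTop
      (𝓝 (a * b + ∫ x in Ioi (0 : ℝ), F x)) := by
    refine hlim.congr fun T => ?_
    have := integral_mul_add_mul_primitive (locallyIntegrable_indicator hw)
      (locallyIntegrable_indicator hz) a b T
    simp only [id, F, primitive] at this ⊢
    rw [this]
    ring
  -- The product of two `L²` functions is integrable, and its continuous representative has a limit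
  -- at infinity, so the limit is zero.
  have h0 := IntegrableAtFilter.eq_zero_of_tendsto
    (⟨Ioi 0, Ioi_mem_atTop _, hPi⟩ : IntegrableAtFilter _ atTop volume) (fun s hs => by
      rcases mem_atTop_sets.1 hs with ⟨b, hb⟩
      rw [← top_le_iff, ← Real.volume_Ici (a := b)]
      exact measure_mono hb) hP
  rw [integral_congr_ae hF]
  exact eq_neg_of_add_eq_zero_right h0

end primitive

/-! ### Boundary values and completeness of `H¹(0, ∞)` -/

section trace

open RCLike

variable {𝕜 : Type*} [RCLike 𝕜]

/-- Integration by parts in terms of inner products. -/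
theorem inner_add_inner_of_ae_eq_primitive {u w v z : L2 𝕜} {a b : 𝕜}
    (huw : ∀ᵐ x ∂(volume.restrict (Ioi (0 : ℝ))), u x = a + primitive w x)
    (hvz : ∀ᵐ x ∂(volume.restrict (Ioi (0 : ℝ))), v x = b + primitive z x) :
    inner 𝕜 w v + inner 𝕜 u z = -(starRingEnd 𝕜 a * b) := by
  have hstar {f : L2 𝕜} : MemLp (fun x => starRingEnd 𝕜 (f x)) 2 (volume.restrict (Ioi (0 : ℝ))) :=
    (Lp.memLp f).star
  rw [← integral_mul_add_mul_Ioi (hstar (f := u)) (hstar (f := w)) (Lp.memLp v) (Lp.memLp z)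
    (by filter_upwards [huw] with x hx; rw [hx, map_add, primitive_conj]) hvz,
    L2.inner_def, L2.inner_def, ← integral_add (L2.integrable_inner _ _) (L2.integrable_inner _ _)]
  refine integral_congr_ae (Eventually.of_forall fun x => ?_)
  simp only [RCLike.inner_apply]
  ring

theorem memLp_exp_neg :
    MemLp (fun x : ℝ => ((Real.exp (-x) : ℝ) : 𝕜)) 2 (volume.restrict (Ioi (0 : ℝ))) := by
  have hc : Continuous fun x : ℝ => ((Real.exp (-x) : ℝ) : 𝕜) :=
    RCLike.continuous_ofReal.comp (Real.continuous_exp.comp continuous_neg)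
  rw [memLp_two_iff_integrable_sq_norm hc.aestronglyMeasurable]
  refine (exp_neg_integrableOn_Ioi 0 two_pos).congr_fun (fun x _ => ?_) measurableSet_Ioi
  simp only [norm_ofReal, abs_of_pos (Real.exp_pos _), sq, ← Real.exp_add]
  ring_nf

/-- The class of `exp (-x)` in `L²(0, ∞)`. -/
noncomputable def expNeg (𝕜 : Type*) [RCLike 𝕜] : L2 𝕜 := memLp_exp_neg.toLp _

theorem expNeg_ae_eq :
    ∀ᵐ x ∂(volume.restrict (Ioi (0 : ℝ))), expNeg 𝕜 x = 1 + primitive (-expNeg 𝕜 : L2 𝕜) x := by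
  have hd (x : ℝ) : HasDerivAt (fun t : ℝ => Real.exp (-t)) (-Real.exp (-x)) x := by
    simpa using (hasDerivAt_neg x).exp
  have he : (expNeg 𝕜 : ℝ → 𝕜) =ᵐ[volume.restrict (Ioi (0 : ℝ))]
      fun x => ((Real.exp (-x) : ℝ) : 𝕜) := memLp_exp_neg.coeFn_toLp
  have he' : ((-expNeg 𝕜 : L2 𝕜) : ℝ → 𝕜) =ᵐ[volume.restrict (Ioi (0 : ℝ))]
      fun x => ((-Real.exp (-x) : ℝ) : 𝕜) := by
    filter_upwards [Lp.coeFn_neg (expNeg 𝕜), he] with x h1 h2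
    rw [h1, Pi.neg_apply, h2, ofReal_neg]
  filter_upwards [he, ae_restrict_mem measurableSet_Ioi] with x hx hm
  rw [primitive_congr he', primitive_deriv hd (by fun_prop) (le_of_lt hm), hx]
  simp

/-- The boundary value `u(0+)` of a function `u` with weak derivative `w`. -/
noncomputable def rightValue (u w : L2 𝕜) : 𝕜 := inner 𝕜 (expNeg 𝕜) (u - w)

/-- Integration by parts against `e^{-x}`, which has value `1` at the vertex and derivative
`-e^{-x}`, identifies the constant of integration as `⟨e^{-x}, u - w⟩`. Written in this way, the
trace is visibly a bounded functional on `H¹`. -/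
theorem HasWeakDeriv.ae_eq {u w : L2 𝕜} (h : HasWeakDeriv u w) :
    ∀ᵐ x ∂(volume.restrict (Ioi (0 : ℝ))), u x = rightValue u w + primitive w x := by
  obtain ⟨a, ha⟩ := h.exists_ae_eq
  have h1 := inner_add_inner_of_ae_eq_primitive (expNeg_ae_eq (𝕜 := 𝕜)) ha
  have e : rightValue u w = a := by
    rw [map_one, one_mul, inner_neg_left] at h1
    rw [rightValue, inner_sub_right, ← neg_inj, ← h1]
    ring
  rwa [e]

theorem HasWeakDeriv.inner_add_inner {u w v z : L2 𝕜} (h : HasWeakDeriv u w)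
    (h' : HasWeakDeriv v z) :
    inner 𝕜 w v + inner 𝕜 u z = -(starRingEnd 𝕜 (rightValue u w) * rightValue v z) :=
  inner_add_inner_of_ae_eq_primitive h.ae_eq h'.ae_eq

theorem hasWeakDeriv_expNeg : HasWeakDeriv (expNeg 𝕜) (-expNeg 𝕜) :=
  hasWeakDeriv_of_ae_eq expNeg_ae_eq

theorem rightValue_eq_of_ae_eq {u w : L2 𝕜} {a : 𝕜}
    (h : ∀ᵐ x ∂(volume.restrict (Ioi (0 : ℝ))), u x = a + primitive w x) : rightValue u w = a := by
  have h1 := (hasWeakDeriv_of_ae_eq h).ae_eq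
  have : ∀ᵐ x ∂(volume.restrict (Ioi (0 : ℝ))), rightValue u w = a := by
    filter_upwards [h, h1] with x h2 h3
    exact add_right_cancel (h3.symm.trans h2)
  have hne : (ae (volume.restrict (Ioi (0 : ℝ)))).NeBot := by
    rw [ae_neBot, Ne, Measure.restrict_eq_zero]
    simp
  exact this.exists.choose_spec

theorem rightValue_expNeg : rightValue (expNeg 𝕜) (-expNeg 𝕜) = 1 :=
  rightValue_eq_of_ae_eq expNeg_ae_eq

/-- Continuous representatives on the open half-line agree everywhere, so any of them can be
replaced by the primitive. -/
theorem HasWeakDeriv.hasRightValue_iff {u w : L2 𝕜} (h : HasWeakDeriv u w) {a : 𝕜} :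
    HasRightValue u a ↔ rightValue u w = a := by
  have hc : Continuous fun x => rightValue u w + primitive w x :=
    continuous_const.add (continuous_primitive (Lp.memLp w))
  have ht : Tendsto (fun x => rightValue u w + primitive w x) (𝓝[>] 0) (𝓝 (rightValue u w)) := by
    have := (hc.tendsto 0).mono_left (nhdsWithin_le_nhds (s := Ioi 0))
    rwa [primitive_zero, add_zero] at this
  constructor
  · rintro ⟨g, hg, hgu, hga⟩
    have heq : EqOn g (fun x => rightValue u w + primitive w x) (Ioi 0) :=
      Measure.eqOn_open_of_ae_eq (hgu.symm.trans h.ae_eq) isOpen_Ioi hg hc.continuousOn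
    refine tendsto_nhds_unique ht (hga.congr' ?_)
    filter_upwards [self_mem_nhdsWithin] with x hx
    exact heq hx
  · rintro rfl
    exact ⟨_, hc.continuousOn, h.ae_eq, ht⟩

/-- Integration by parts of `u` against itself. The product on the right is what makes the vertex
term a small perturbation of the gradient term. -/
theorem HasWeakDeriv.norm_rightValue_sq_le {u w : L2 𝕜} (h : HasWeakDeriv u w) :
    ‖rightValue u w‖ ^ 2 ≤ 2 * (‖u‖ * ‖w‖) := by
  have h1 := congrArg norm (h.inner_add_inner h)
  rw [norm_neg, norm_mul, norm_conj, ← sq] at h1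
  rw [← h1]
  refine (norm_add_le _ _).trans ?_
  have h2 := norm_inner_le_norm (𝕜 := 𝕜) w u
  have h3 := norm_inner_le_norm (𝕜 := 𝕜) u w
  linarith

/-- Test functions as elements of `H¹(0, ∞)`. -/
theorem exists_test {η : ℝ → ℝ} (hη : ContDiff ℝ ∞ η) (hs : HasCompactSupport η)
    (ht : tsupport η ⊆ Ioi 0) :
    ∃ t t' : L2 𝕜, HasWeakDeriv t t' ∧ rightValue t t' = 0 ∧
      (∀ f : L2 𝕜, inner 𝕜 t f = ∫ x in Ioi (0 : ℝ), η x • f x) ∧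
      ∀ f : L2 𝕜, inner 𝕜 t' f = ∫ x in Ioi (0 : ℝ), deriv η x • f x := by
  have hd : Continuous (deriv η) := hη.continuous_deriv (by simp)
  have hdη (x : ℝ) : HasDerivAt η (deriv η x) x :=
    (hη.differentiable (by simp) x).hasDerivAt
  have hmem {ζ : ℝ → ℝ} (hc : Continuous ζ) (hs : HasCompactSupport ζ) :
      MemLp (fun x => (ζ x : 𝕜)) 2 (volume.restrict (Ioi (0 : ℝ))) :=
    ((hc.memLp_of_hasCompactSupport hs).restrict _).ofReal
  have hin {ζ : ℝ → ℝ} (hc : Continuous ζ) (hs : HasCompactSupport ζ) (f : L2 𝕜) :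
      inner 𝕜 ((hmem hc hs).toLp _ : L2 𝕜) f = ∫ x in Ioi (0 : ℝ), ζ x • f x := by
    rw [L2.inner_def]
    refine integral_congr_ae ?_
    filter_upwards [(hmem hc hs).coeFn_toLp] with x hx
    rw [hx, RCLike.inner_apply, conj_ofReal, real_smul_eq_coe_mul, mul_comm]
  have hη0 : η 0 = 0 := image_eq_zero_of_notMem_tsupport fun h => lt_irrefl _ (mem_Ioi.1 (ht h))
  have hrep : ∀ᵐ x ∂(volume.restrict (Ioi (0 : ℝ))),
      ((hmem hη.continuous hs).toLp _ : L2 𝕜) x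
        = 0 + primitive ((hmem hd hs.deriv).toLp _ : L2 𝕜) x := by
    filter_upwards [(hmem hη.continuous hs).coeFn_toLp, ae_restrict_mem measurableSet_Ioi]
      with x hx hm
    rw [primitive_congr (hmem hd hs.deriv).coeFn_toLp, primitive_deriv hdη hd (le_of_lt hm), hx,
      hη0]
    simp
  exact ⟨_, _, hasWeakDeriv_of_ae_eq hrep, rightValue_eq_of_ae_eq hrep, hin hη.continuous hs,
    hin hd hs.deriv⟩

/-- Integration by parts against functions of zero trace expresses membership by equations
continuous in the pair; test functions already suffice for the converse. -/
theorem isClosed_H1 : IsClosed (H1 𝕜 : Set (WithLp 2 (L2 𝕜 × L2 𝕜))) := by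
  have e : (H1 𝕜 : Set (WithLp 2 (L2 𝕜 × L2 𝕜))) = ⋂ (t : L2 𝕜) (t' : L2 𝕜)
      (_ : HasWeakDeriv t t' ∧ rightValue t t' = 0),
      {p | inner 𝕜 t' p.fst = -inner 𝕜 t p.snd} := by
    ext p
    simp only [mem_iInter, SetLike.mem_coe, mem_ofPred_eq]
    constructor
    · intro hp t t' ht
      have := ht.1.inner_add_inner (show HasWeakDeriv p.fst p.snd from hp)
      rw [ht.2, map_zero, zero_mul, neg_zero] at this
      exact eq_neg_of_add_eq_zero_left this
    · intro hp η hη hs ht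
      obtain ⟨t, t', h1, h2, h3, h4⟩ := exists_test (𝕜 := 𝕜) hη hs ht
      rw [← h3, ← h4]
      exact hp t t' ⟨h1, h2⟩
  rw [e]
  refine isClosed_iInter fun t => isClosed_iInter fun t' => isClosed_iInter fun _ => ?_
  refine isClosed_eq ?_ ?_
  · exact continuous_const.inner (WithLp.continuous_fst _ _ _)
  · exact (continuous_const.inner (WithLp.continuous_snd _ _ _)).neg

instance : CompleteSpace (H1 𝕜) := isClosed_H1.completeSpace_coe

end trace

/-! ### The quadratic form, its operator and the Gårding inequality -/

noncomputable section form

open RCLike ContinuousLinearMap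

variable {𝕜 : Type*} [RCLike 𝕜]

/-- The inclusion `H¹(0, ∞) ⊆ L²(0, ∞)`. -/
def H1.val (𝕜 : Type*) [RCLike 𝕜] : H1 𝕜 →L[𝕜] L2 𝕜 :=
  WithLp.fstL 2 𝕜 (L2 𝕜) (L2 𝕜) ∘L (H1 𝕜).subtypeL

/-- The derivative `H¹(0, ∞) → L²(0, ∞)`. -/
def H1.der (𝕜 : Type*) [RCLike 𝕜] : H1 𝕜 →L[𝕜] L2 𝕜 :=
  WithLp.sndL 2 𝕜 (L2 𝕜) (L2 𝕜) ∘L (H1 𝕜).subtypeL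

/-- The boundary value `H¹(0, ∞) → 𝕜`. -/
def H1.trace (𝕜 : Type*) [RCLike 𝕜] : H1 𝕜 →L[𝕜] 𝕜 :=
  innerSL 𝕜 (expNeg 𝕜) ∘L (H1.val 𝕜 - H1.der 𝕜)

theorem H1.hasWeakDeriv (u : H1 𝕜) : HasWeakDeriv (H1.val 𝕜 u) (H1.der 𝕜 u) := u.2

theorem H1.trace_apply (u : H1 𝕜) :
    H1.trace 𝕜 u = rightValue (H1.val 𝕜 u) (H1.der 𝕜 u) := rfl

/-- The element of `H¹(0, ∞)` with given weak derivative. -/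
def H1.mk {u w : L2 𝕜} (h : HasWeakDeriv u w) : H1 𝕜 := ⟨WithLp.toLp 2 (u, w), h⟩

theorem H1.norm_sq (u : H1 𝕜) : ‖u‖ ^ 2 = ‖H1.val 𝕜 u‖ ^ 2 + ‖H1.der 𝕜 u‖ ^ 2 :=
  WithLp.prod_norm_sq_eq_of_L2 u.1

/-- A weak Neumann problem on an edge: regularity and natural boundary condition. -/
theorem H1.weak_neumann_iff {c : ℝ} (hc : c ≠ 0) (p : H1 𝕜) (f : L2 𝕜) (κ : 𝕜) :
    (∀ h : H1 𝕜, (c : 𝕜) ^ 2 * inner 𝕜 (H1.der 𝕜 p) (H1.der 𝕜 h)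
        + starRingEnd 𝕜 κ * H1.trace 𝕜 h = inner 𝕜 f (H1.val 𝕜 h)) ↔
      ∃ e : L2 𝕜, HasWeakDeriv (H1.der 𝕜 p) e ∧ -((c : 𝕜) ^ 2 • e) = f ∧
        (c : 𝕜) ^ 2 * rightValue (H1.der 𝕜 p) e = κ := by
  have hc' : (c : 𝕜) ^ 2 ≠ 0 := pow_ne_zero 2 (ofReal_ne_zero.2 hc)
  have hconj : starRingEnd 𝕜 ((c : 𝕜) ^ 2) = (c : 𝕜) ^ 2 := by rw [map_pow, conj_ofReal]
  constructor
  · intro H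
    obtain ⟨e, he⟩ : ∃ e : L2 𝕜, -((c : 𝕜) ^ 2 • e) = f :=
      ⟨-(((c : 𝕜) ^ 2)⁻¹ • f), by rw [smul_neg, neg_neg, smul_inv_smul₀ hc']⟩
    have hf (v : L2 𝕜) : inner 𝕜 f v = -((c : 𝕜) ^ 2 * inner 𝕜 e v) := by
      rw [← he, inner_neg_left, inner_smul_left, hconj]
    -- Test functions have zero trace, so they detect only the differential equation.
    have hwd : HasWeakDeriv (H1.der 𝕜 p) e := by
      intro η hη hs ht
      obtain ⟨t, t', h1, h2, h3, h4⟩ := exists_test (𝕜 := 𝕜) hη hs ht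
      have h5 : (c : 𝕜) ^ 2 * inner 𝕜 (H1.der 𝕜 p) t' + starRingEnd 𝕜 κ * rightValue t t'
          = inner 𝕜 f t := H (H1.mk h1)
      rw [h2, mul_zero, add_zero, hf, ← mul_neg] at h5
      rw [← h3, ← h4, ← inner_conj_symm, mul_left_cancel₀ hc' h5, map_neg, inner_conj_symm]
    refine ⟨e, hwd, he, ?_⟩
    -- Once the equation holds, a single function of trace `1` recovers the boundary condition.
    have h5 : (c : 𝕜) ^ 2 * inner 𝕜 (H1.der 𝕜 p) (-expNeg 𝕜)
        + starRingEnd 𝕜 κ * rightValue (expNeg 𝕜) (-expNeg 𝕜) = inner 𝕜 f (expNeg 𝕜) :=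
      H (H1.mk hasWeakDeriv_expNeg)
    have h6 := hwd.inner_add_inner (hasWeakDeriv_expNeg (𝕜 := 𝕜))
    rw [rightValue_expNeg, mul_one] at h5 h6
    rw [hf] at h5
    have h7 : starRingEnd 𝕜 ((c : 𝕜) ^ 2 * rightValue (H1.der 𝕜 p) e) = starRingEnd 𝕜 κ := by
      rw [map_mul, hconj]
      linear_combination (c : 𝕜) ^ 2 * h6 - h5
    exact (starRingEnd 𝕜).injective h7
  · rintro ⟨e, hwd, rfl, rfl⟩ h
    have h6 := hwd.inner_add_inner (H1.hasWeakDeriv h)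
    rw [inner_neg_left, inner_smul_left, map_mul, hconj, H1.trace_apply]
    linear_combination (c : 𝕜) ^ 2 * h6

/-- The diagonal operator with entries `f j` between direct sums over the edges. -/
def diagCLM {E F : Type*} [NormedAddCommGroup E] [NormedSpace 𝕜 E] [NormedAddCommGroup F]
    [NormedSpace 𝕜 F] (f : Fin 3 → E →L[𝕜] F) :
    PiLp 2 (fun _ : Fin 3 => E) →L[𝕜] PiLp 2 (fun _ : Fin 3 => F) :=
  (PiLp.continuousLinearEquiv 2 𝕜 (fun _ : Fin 3 => F)).symm.toContinuousLinearMap ∘L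
    ContinuousLinearMap.pi fun j => f j ∘L PiLp.proj 2 (fun _ : Fin 3 => E) j

theorem diagCLM_apply {E F : Type*} [NormedAddCommGroup E] [NormedSpace 𝕜 E]
    [NormedAddCommGroup F] [NormedSpace 𝕜 F] (f : Fin 3 → E →L[𝕜] F)
    (u : PiLp 2 (fun _ : Fin 3 => E)) (j : Fin 3) : diagCLM f u j = f j (u j) := rfl

theorem norm_mulCos_le (ζ : C(ℝ, ℝ)) (u : L2 𝕜) : ‖mulCos 𝕜 ζ u‖ ≤ 1 * ‖u‖ := by
  rw [one_mul]
  refine Lp.norm_le_norm_of_ae_le ?_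
  filter_upwards [(memLp_cos_mul ζ u).coeFn_toLp] with x hx
  change ‖((memLp_cos_mul ζ u).toLp _ : L2 𝕜) x‖ ≤ _
  rw [hx, norm_mul, norm_ofReal]
  exact mul_le_of_le_one_left (norm_nonneg _) (Real.abs_cos_le_one _)

/-- Multiplication by `cos ζ` as a bounded operator. -/
def mulCosL (𝕜 : Type*) [RCLike 𝕜] (ζ : C(ℝ, ℝ)) : L2 𝕜 →L[𝕜] L2 𝕜 :=
  (mulCos 𝕜 ζ).mkContinuous 1 (norm_mulCos_le ζ)

theorem inner_mulCosL (ζ : C(ℝ, ℝ)) (u v : L2 𝕜) :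
    inner 𝕜 (mulCosL 𝕜 ζ u) v = inner 𝕜 u (mulCosL 𝕜 ζ v) := by
  rw [L2.inner_def, L2.inner_def]
  refine integral_congr_ae ?_
  filter_upwards [(memLp_cos_mul ζ u).coeFn_toLp, (memLp_cos_mul ζ v).coeFn_toLp] with x h1 h2
  have h1' : mulCosL 𝕜 ζ u x = (Real.cos (ζ x) : 𝕜) * u x := h1
  have h2' : mulCosL 𝕜 ζ v x = (Real.cos (ζ x) : 𝕜) * v x := h2
  rw [h1', h2', RCLike.inner_apply, RCLike.inner_apply, map_mul, conj_ofReal]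
  ring

variable (𝕜) in
/-- The inclusion `H¹(𝒴) ⊆ L²(𝒴)` as a bounded operator. -/
def inclH1YL : H1Y 𝕜 →L[𝕜] L2Y 𝕜 := diagCLM fun _ => H1.val 𝕜

variable (𝕜) in
/-- The weighted vertex sum `∑ c_j u_j(0+)`. -/
def vertexSum (c : Fin 3 → ℝ) : H1Y 𝕜 →L[𝕜] 𝕜 :=
  ∑ j, (c j : 𝕜) • (H1.trace 𝕜 ∘L PiLp.proj 2 (fun _ : Fin 3 => H1 𝕜) j)

theorem vertexSum_apply (c : Fin 3 → ℝ) (u : H1Y 𝕜) :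
    vertexSum 𝕜 c u = ∑ j, (c j : 𝕜) * H1.trace 𝕜 (u j) := by
  simp [vertexSum]

variable (𝕜) in
/-- The weighted derivative `(c_j u_j')`. -/
def derH1Y (c : Fin 3 → ℝ) : H1Y 𝕜 →L[𝕜] L2Y 𝕜 := diagCLM fun j => (c j : 𝕜) • H1.der 𝕜

variable (𝕜) in
/-- The operator on `H¹(𝒴)` representing the quadratic form of the Schrödinger operator with
`δ'`-interaction. -/
def formOp (c : Fin 3 → ℝ) (ζ : Fin 3 → C(ℝ, ℝ)) (lam : ℝ) : H1Y 𝕜 →L[𝕜] H1Y 𝕜 :=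
  adjoint (derH1Y 𝕜 c) ∘L derH1Y 𝕜 c
    + ((lam⁻¹ : ℝ) : 𝕜) • (adjoint (vertexSum 𝕜 c) ∘L vertexSum 𝕜 c)
    + adjoint (inclH1YL 𝕜) ∘L diagCLM (fun j => mulCosL 𝕜 (ζ j)) ∘L inclH1YL 𝕜

variable {c : Fin 3 → ℝ} {ζ : Fin 3 → C(ℝ, ℝ)} {lam : ℝ}

theorem inner_formOp_eq (u v : H1Y 𝕜) :
    inner 𝕜 (formOp 𝕜 c ζ lam u) v = inner 𝕜 (derH1Y 𝕜 c u) (derH1Y 𝕜 c v)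
      + ((lam⁻¹ : ℝ) : 𝕜) * inner 𝕜 (vertexSum 𝕜 c u) (vertexSum 𝕜 c v)
      + inner 𝕜 (diagCLM (fun j => mulCosL 𝕜 (ζ j)) (inclH1YL 𝕜 u)) (inclH1YL 𝕜 v) := by
  simp only [formOp, add_apply, smul_apply, comp_apply, inner_add_left, inner_smul_left,
    conj_ofReal, adjoint_inner_left]

theorem inner_formOp_symm (u v : H1Y 𝕜) :
    inner 𝕜 (formOp 𝕜 c ζ lam u) v = inner 𝕜 u (formOp 𝕜 c ζ lam v) := by
  have hM : inner 𝕜 (diagCLM (fun j => mulCosL 𝕜 (ζ j)) (inclH1YL 𝕜 u)) (inclH1YL 𝕜 v)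
      = inner 𝕜 (inclH1YL 𝕜 u) (diagCLM (fun j => mulCosL 𝕜 (ζ j)) (inclH1YL 𝕜 v)) := by
    simp only [PiLp.inner_apply, diagCLM_apply, inner_mulCosL]
  rw [inner_formOp_eq, ← inner_conj_symm u, inner_formOp_eq, hM]
  simp only [map_add, map_mul, conj_ofReal, inner_conj_symm]

/-- For fixed `u`, the edges are coupled only through the scalar `λ⁻¹ ∑ c_k u_k(0+)`, which enters
edge `j` as a Neumann datum with weight `c_j`. -/
theorem inner_formOp_apply (u v : H1Y 𝕜) :
    inner 𝕜 (formOp 𝕜 c ζ lam u) v = ∑ j, ((c j : 𝕜) ^ 2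
        * inner 𝕜 (H1.der 𝕜 (u j)) (H1.der 𝕜 (v j))
      + starRingEnd 𝕜 (((lam⁻¹ : ℝ) : 𝕜) * vertexSum 𝕜 c u * (c j : 𝕜)) * H1.trace 𝕜 (v j)
      + inner 𝕜 (mulCosL 𝕜 (ζ j) (H1.val 𝕜 (u j))) (H1.val 𝕜 (v j))) := by
  rw [inner_formOp_eq, Finset.sum_add_distrib, Finset.sum_add_distrib, RCLike.inner_apply,
    vertexSum_apply c v, PiLp.inner_apply, PiLp.inner_apply, Finset.sum_mul, Finset.mul_sum]
  congr 2
  · refine Finset.sum_congr rfl fun j _ => ?_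
    change inner 𝕜 ((c j : 𝕜) • H1.der 𝕜 (u j)) ((c j : 𝕜) • H1.der 𝕜 (v j)) = _
    rw [inner_smul_left, inner_smul_right, conj_ofReal]
    ring
  · refine Finset.sum_congr rfl fun j _ => ?_
    rw [map_mul, map_mul, conj_ofReal, conj_ofReal]
    ring

/-- The equation `formOp u = incl* g` can be tested edge by edge. -/
theorem formOp_eq_adjoint_iff (u : H1Y 𝕜) (g : L2Y 𝕜) :
    formOp 𝕜 c ζ lam u = adjoint (inclH1YL 𝕜) g ↔ ∀ (j : Fin 3) (h : H1 𝕜),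
      (c j : 𝕜) ^ 2 * inner 𝕜 (H1.der 𝕜 (u j)) (H1.der 𝕜 h)
      + starRingEnd 𝕜 (((lam⁻¹ : ℝ) : 𝕜) * vertexSum 𝕜 c u * (c j : 𝕜)) * H1.trace 𝕜 h
      = inner 𝕜 (g j - mulCosL 𝕜 (ζ j) (H1.val 𝕜 (u j))) (H1.val 𝕜 h) := by
  have hg (v : H1Y 𝕜) : inner 𝕜 (adjoint (inclH1YL 𝕜) g) v
      = ∑ j, inner 𝕜 (g j) (H1.val 𝕜 (v j)) := by
    rw [adjoint_inner_left, PiLp.inner_apply]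
    rfl
  constructor
  · intro H j h
    have h1 := hg (WithLp.toLp 2 (Pi.single j h))
    rw [← H, inner_formOp_apply, Finset.sum_eq_single j, Finset.sum_eq_single j] at h1
    · simp only [Pi.single_eq_same] at h1
      rw [inner_sub_left, ← h1]
      ring
    · intro k _ hk
      simp [Pi.single_eq_of_ne hk]
    · simp
    · intro k _ hk
      simp [Pi.single_eq_of_ne hk]
    · simp
  · intro H
    refine ext_inner_right 𝕜 fun v => ?_
    rw [hg, inner_formOp_apply]
    refine Finset.sum_congr rfl fun j _ => ?_
    rw [H j (v j), inner_sub_left]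
    ring

/-- The operator of the form is the Schrödinger operator with `δ'`-interaction. -/
theorem mem_graph_schrodinger_iff (hc : ∀ j, 0 < c j) (hlam : lam ≠ 0) (u : H1Y 𝕜) (g : L2Y 𝕜) :
    (inclH1Y 𝕜 u, g) ∈ (schrodinger 𝕜 c ζ lam).graph ↔
      formOp 𝕜 c ζ lam u = adjoint (inclH1YL 𝕜) g := by
  have hc' (j : Fin 3) : (c j : 𝕜) ≠ 0 := ofReal_ne_zero.2 (hc j).ne'
  have hlam' : (lam : 𝕜) ≠ 0 := ofReal_ne_zero.2 hlam
  have hval (j : Fin 3) : inclH1Y 𝕜 u j = H1.val 𝕜 (u j) := rfl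
  have hwd (j : Fin 3) : HasWeakDeriv (inclH1Y 𝕜 u j) (H1.der 𝕜 (u j)) := H1.hasWeakDeriv (u j)
  rw [formOp_eq_adjoint_iff]
  simp only [H1.weak_neumann_iff (hc _).ne']
  rw [LinearPMap.mem_graph_iff]
  constructor
  · rintro ⟨⟨p, hp⟩, hpu, hpg⟩ j
    obtain rfl : p = inclH1Y 𝕜 u := hpu
    obtain ⟨d, e, a, s, h1, h2, h3, h4, h5, h6, h7⟩ := id hp
    obtain rfl : d = fun j => H1.der 𝕜 (u j) := funext fun j => (h1 j).unique (hwd j)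
    obtain rfl : a = fun j => H1.trace 𝕜 (u j) :=
      funext fun j => ((hwd j).hasRightValue_iff.1 (h3 j)).symm
    have hs (j : Fin 3) : rightValue (H1.der 𝕜 (u j)) (e j) = s j := (h2 j).hasRightValue_iff.1 (h4 j)
    refine ⟨e j, h2 j, ?_, ?_⟩
    · have hj : -((c j : 𝕜) ^ 2 • weakDeriv (weakDeriv (inclH1Y 𝕜 u j)))
          + mulCosL 𝕜 (ζ j) (H1.val 𝕜 (u j)) = g j := congrArg (fun z : L2Y 𝕜 => z j) hpg
      rw [(hwd j).weakDeriv_eq, (h2 j).weakDeriv_eq] at hj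
      rw [← hj, add_sub_cancel_right]
    · have hk : (c j : 𝕜) * s j = (c 0 : 𝕜) * s 0 := by
        fin_cases j
        · rfl
        · exact h5.symm
        · exact (h5.trans h6).symm
      rw [hs, vertexSum_apply, h7, sq, mul_assoc, hk, ofReal_inv, inv_mul_cancel_left₀ hlam',
        mul_comm]
  · intro H
    choose e h1 h2 h3 using H
    -- Cancelling one factor `c_j` from the natural condition shows that `c_j u_j'(0+)` equals `λ⁻¹
    -- ∑ c_k u_k(0+)` for every `j`, which contains all the vertex conditions.
    have hk (j : Fin 3) : (c j : 𝕜) * rightValue (H1.der 𝕜 (u j)) (e j)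
        = ((lam⁻¹ : ℝ) : 𝕜) * vertexSum 𝕜 c u := by
      have := h3 j
      rw [sq, mul_assoc, mul_comm] at this
      exact mul_right_cancel₀ (hc' j) this
    have hmem : inclH1Y 𝕜 u ∈ (schrodinger 𝕜 c ζ lam).domain :=
      ⟨fun j => H1.der 𝕜 (u j), e, fun j => H1.trace 𝕜 (u j),
        fun j => rightValue (H1.der 𝕜 (u j)) (e j), hwd, h1,
        fun j => (hwd j).hasRightValue_iff.2 rfl, fun j => (h1 j).hasRightValue_iff.2 rfl,
        by rw [hk, hk], by rw [hk, hk], by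
          rw [hk, ← vertexSum_apply, ofReal_inv, mul_inv_cancel_left₀ hlam']⟩
    refine ⟨⟨_, hmem⟩, rfl, ?_⟩
    ext1 j
    change -((c j : 𝕜) ^ 2 • weakDeriv (weakDeriv (inclH1Y 𝕜 u j)))
          + mulCosL 𝕜 (ζ j) (H1.val 𝕜 (u j)) = g j
    rw [(hwd j).weakDeriv_eq, (h1 j).weakDeriv_eq, h2, sub_add_cancel]

/-- Gårding inequality for the form. -/
theorem exists_coercive_formOp (hc : ∀ j, 0 < c j) :
    ∃ m K : ℝ, 0 < m ∧ 0 ≤ K ∧ ∀ u : H1Y 𝕜,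
      m * ‖u‖ ^ 2 ≤ re (inner 𝕜 (formOp 𝕜 c ζ lam u) u) + K * ‖inclH1YL 𝕜 u‖ ^ 2 := by
  obtain ⟨m, hm, hmc⟩ : ∃ m : ℝ, 0 < m ∧ ∀ j, 2 * m ≤ c j ^ 2 := by
    obtain ⟨j₀, hj₀⟩ := Finite.exists_min c
    refine ⟨c j₀ ^ 2 / 2, by have := hc j₀; positivity, fun j => ?_⟩
    have := pow_le_pow_left₀ (hc j₀).le (hj₀ j) 2
    linarith
  obtain ⟨k, hk⟩ : ∃ k : ℝ, ∀ j, c j ^ 2 ≤ k := by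
    obtain ⟨j₀, hj₀⟩ := Finite.exists_max fun j => c j ^ 2
    exact ⟨_, hj₀⟩
  have hk0 : 0 ≤ k := (sq_nonneg _).trans (hk 0)
  -- In `K`, the `m` supplies the `L²` part of the `H¹` norm, the `1` compensates `cos ≥ -1`, and
  -- the last term pays for the vertex term. Half of the gradient term is spent there; the other
  -- half dominates `m ‖u_j'‖²`.
  refine ⟨m, m + 1 + 18 * lam⁻¹ ^ 2 * k, hm, by positivity, fun u => ?_⟩
  set a : Fin 3 → ℝ := fun j => ‖H1.val 𝕜 (u j)‖ with ha
  set d : Fin 3 → ℝ := fun j => ‖H1.der 𝕜 (u j)‖ with hd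
  have e1 : ‖u‖ ^ 2 = ∑ j, (a j ^ 2 + d j ^ 2) := by
    rw [PiLp.norm_sq_eq_of_L2]
    exact Finset.sum_congr rfl fun j _ => H1.norm_sq (u j)
  have e2 : ‖inclH1YL 𝕜 u‖ ^ 2 = ∑ j, a j ^ 2 := by
    rw [PiLp.norm_sq_eq_of_L2]
    rfl
  have e3 : ‖derH1Y 𝕜 c u‖ ^ 2 = ∑ j, c j ^ 2 * d j ^ 2 := by
    rw [PiLp.norm_sq_eq_of_L2]
    refine Finset.sum_congr rfl fun j _ => ?_
    change ‖(c j : 𝕜) • H1.der 𝕜 (u j)‖ ^ 2 = _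
    rw [norm_smul, norm_ofReal, mul_pow, sq_abs]
  -- The factor `6` is `3` from Cauchy-Schwarz over the edges times `2` from the trace inequality.
  have e4 : ‖vertexSum 𝕜 c u‖ ^ 2 ≤ ∑ j, 6 * c j ^ 2 * (a j * d j) := by
    have h1 : ‖vertexSum 𝕜 c u‖ ≤ ∑ j, c j * ‖H1.trace 𝕜 (u j)‖ := by
      rw [vertexSum_apply]
      refine (norm_sum_le _ _).trans (Finset.sum_le_sum fun j _ => ?_)
      rw [norm_mul, norm_ofReal, abs_of_pos (hc j)]
    have h2 := sq_sum_le_card_mul_sum_sq (s := Finset.univ)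
      (f := fun j => c j * ‖H1.trace 𝕜 (u j)‖)
    have h3 := pow_le_pow_left₀ (norm_nonneg _) h1 2
    refine h3.trans (h2.trans ?_)
    rw [Finset.mul_sum]
    refine Finset.sum_le_sum fun j _ => ?_
    have h4 := (H1.hasWeakDeriv (u j)).norm_rightValue_sq_le
    rw [← H1.trace_apply] at h4
    have h5 := mul_le_mul_of_nonneg_left h4 (sq_nonneg (c j))
    simp only [Finset.card_univ, Fintype.card_fin]
    push_cast
    rw [mul_pow]
    simp only [ha, hd]
    linarith
  have e5 : -∑ j, a j ^ 2
      ≤ re (inner 𝕜 (diagCLM (fun j => mulCosL 𝕜 (ζ j)) (inclH1YL 𝕜 u)) (inclH1YL 𝕜 u)) := by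
    rw [PiLp.inner_apply, map_sum, ← Finset.sum_neg_distrib]
    refine Finset.sum_le_sum fun j _ => ?_
    have h1 := (neg_abs_le _).trans' (neg_le_neg ((abs_re_le_norm _).trans
      (norm_inner_le_norm (𝕜 := 𝕜) (mulCosL 𝕜 (ζ j) (H1.val 𝕜 (u j))) (H1.val 𝕜 (u j)))))
    refine le_trans ?_ h1
    have h2 : ‖mulCosL 𝕜 (ζ j) (H1.val 𝕜 (u j))‖ ≤ 1 * a j := norm_mulCos_le _ _
    have h3 : 0 ≤ a j := norm_nonneg _
    simp only [ha] at h2 h3 ⊢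
    nlinarith
  have e6 : -∑ j, (c j ^ 2 * (d j ^ 2 / 2) + 18 * lam⁻¹ ^ 2 * k * a j ^ 2)
      ≤ lam⁻¹ * ‖vertexSum 𝕜 c u‖ ^ 2 := by
    have h1 : -(|lam⁻¹| * ‖vertexSum 𝕜 c u‖ ^ 2) ≤ lam⁻¹ * ‖vertexSum 𝕜 c u‖ ^ 2 := by
      rw [← neg_mul]
      exact mul_le_mul_of_nonneg_right (neg_abs_le _) (sq_nonneg _)
    refine le_trans (neg_le_neg ?_) h1
    refine (mul_le_mul_of_nonneg_left e4 (abs_nonneg _)).trans ?_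
    rw [Finset.mul_sum]
    refine Finset.sum_le_sum fun j _ => ?_
    have h2 : |lam⁻¹| * (6 * c j ^ 2 * (a j * d j))
        ≤ c j ^ 2 * (d j ^ 2 / 2 + 18 * lam⁻¹ ^ 2 * a j ^ 2) := by
      -- Young's inequality: the difference of the two sides is half of `(d - 6 |λ⁻¹| a)²`.
      have h3 : |lam⁻¹| * (6 * (a j * d j)) ≤ d j ^ 2 / 2 + 18 * lam⁻¹ ^ 2 * a j ^ 2 := by
        rw [← sq_abs lam⁻¹]
        nlinarith [sq_nonneg (d j - 6 * |lam⁻¹| * a j)]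
      have := mul_le_mul_of_nonneg_left h3 (sq_nonneg (c j))
      linarith
    have h4 : c j ^ 2 * (lam⁻¹ ^ 2 * a j ^ 2) ≤ k * (lam⁻¹ ^ 2 * a j ^ 2) :=
      mul_le_mul_of_nonneg_right (hk j) (by positivity)
    linarith
  rw [inner_formOp_eq, map_add, map_add, re_ofReal_mul, inner_self_eq_norm_sq,
    inner_self_eq_norm_sq, e1, e2, e3]
  have e7 : ∑ j, m * d j ^ 2 ≤ ∑ j, c j ^ 2 * (d j ^ 2 / 2) :=
    Finset.sum_le_sum fun j _ => by nlinarith [hmc j, sq_nonneg (d j)]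
  simp only [Finset.sum_add_distrib, mul_add, add_mul, ← Finset.mul_sum] at *
  have e8 : ∑ j, c j ^ 2 * (d j ^ 2 / 2) = (∑ j, c j ^ 2 * d j ^ 2) / 2 := by
    rw [Finset.sum_div]
    exact Finset.sum_congr rfl fun j _ => by ring
  linarith

end form

/-! ### The graph of `J ℰ` in the energy space and the conclusion -/

section generator

variable {𝕜 : Type*} [RCLike 𝕜]

/-- The graph of the part of `J diag(W, I)` in the energy space. -/
theorem mem_graph_partInEnergy_opJ_diagId (W : L2Y 𝕜 →ₗ.[𝕜] L2Y 𝕜) (x y : Energy 𝕜) :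
    (x, y) ∈ (partInEnergy ((opJ 𝕜).compPMap (diagId W))).graph ↔
      inclH1Y 𝕜 y.fst = x.snd ∧ (inclH1Y 𝕜 x.fst, -y.snd) ∈ W.graph := by
  rw [mem_graph_partInEnergy, LinearPMap.mem_graph_iff, LinearPMap.mem_graph_iff]
  constructor
  · rintro ⟨⟨p, hp⟩, hpx, hpy⟩
    obtain rfl : p = inclEnergy 𝕜 x := hpx
    have h1 : x.snd = inclH1Y 𝕜 y.fst := congrArg (fun z : L2Y2 𝕜 => z.fst) hpy
    have h2 : -W ⟨inclH1Y 𝕜 x.fst, hp⟩ = y.snd := congrArg (fun z : L2Y2 𝕜 => z.snd) hpy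
    exact ⟨h1.symm, ⟨inclH1Y 𝕜 x.fst, hp⟩, rfl, by rw [← h2, neg_neg]⟩
  · rintro ⟨h1, ⟨p, hp⟩, hpx, hpy⟩
    obtain rfl : p = inclH1Y 𝕜 x.fst := hpx
    refine ⟨⟨inclEnergy 𝕜 x, hp⟩, rfl, ?_⟩
    apply WithLp.ofLp_injective 2
    refine Prod.ext h1.symm ?_
    change -W ⟨inclH1Y 𝕜 x.fst, hp⟩ = y.snd
    rw [hpy, neg_neg]

end generator

end Tricrystal

theorem proposition3p3 {𝕜 : Type*} [RCLike 𝕜] (c b : Fin 3 → ℝ) (hc : ∀ j, 0 < c j)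
    (lam : ℝ) (hlam : lam ≠ 0) :
    (∀ x : Tricrystal.Energy 𝕜, x ∈ (Tricrystal.kinkJE 𝕜 c b lam).domain ↔
      Tricrystal.inclH1Y 𝕜 x.fst ∈ (Tricrystal.kinkLinearization 𝕜 c b lam).domain ∧
        x.snd ∈ LinearMap.range (Tricrystal.inclH1Y 𝕜)) ∧
    ∃ S : NNReal → Tricrystal.Energy 𝕜 →L[𝕜] Tricrystal.Energy 𝕜,
      Tricrystal.IsC0Semigroup S ∧
        Tricrystal.IsGenerator (Tricrystal.kinkJE 𝕜 c b lam) S := by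
  refine ⟨fun x => ?_, ?_⟩
  · rw [LinearPMap.mem_domain_iff]
    constructor
    · rintro ⟨y, hy⟩
      obtain ⟨h1, h2⟩ := (Tricrystal.mem_graph_partInEnergy_opJ_diagId _ x y).1 hy
      exact ⟨LinearPMap.mem_domain_of_mem_graph h2, y.fst, h1⟩
    · rintro ⟨h1, v, h2⟩
      refine ⟨WithLp.toLp 2 (v, -Tricrystal.kinkLinearization 𝕜 c b lam ⟨_, h1⟩),
        (Tricrystal.mem_graph_partInEnergy_opJ_diagId _ x _).2 ⟨h2, ?_⟩⟩
      have h3 := (Tricrystal.kinkLinearization 𝕜 c b lam).mem_graph ⟨_, h1⟩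
      simpa using h3
  · obtain ⟨m, K, hm, hK, hcoer⟩ := Tricrystal.exists_coercive_formOp (𝕜 := 𝕜)
      (ζ := fun j => Tricrystal.kink (c j) (b j)) (lam := lam) hc
    refine Tricrystal.exists_isGenerator_wave Tricrystal.inner_formOp_symm hm hK hcoer
      fun x y => (Tricrystal.mem_graph_partInEnergy_opJ_diagId _ x y).trans
        (and_congr Iff.rfl ?_)
    rw [← map_neg]
    exact Tricrystal.mem_graph_schrodinger_iff hc hlam x.fst (-y.snd)
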